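/- **Setting.** Let $\Omega$ be a nonempty finite set. Let $\Psi$ be a set of weight functions $\psi:\Omega^{k_\psi}\to(0,\infty)$ of arities $k_\psi\ge 1$, and let $(\rho_\psi)_{\psi\in\Psi}$ be positive reals with $\sum_{\psi\in\Psi}\rho_\psi k_\psi<\infty$ (no condition if $\Psi$ is finite). *Random factor graph.* The random factor graph $G_n$ has variable nodes $x_1,\dots,x_n$. For each $\psi\in\Psi$ it has $m_\psi\sim\mathrm{Po}(n\rho_\psi)$ constraint nodes of type $\psi$, with the $m_\psi$ independent. Each constraint node $a$ of type $\psi_a=\psi$ chooses an ordered tuple of neighbours $\partial a\in\{x_1,\dots,x_n\}^{k_\psi}$ uniformly and independently of everything else. Its Gibbs measure $\mu_{G_n}$ on $\Omega^n$ is given by $\mu_{G_n}(\sigma)\propto\prod_a\psi_a(\sigma(\partial a))$. Distances in $G_n$ are those of the bipartite graph of variable and constraint nodes, with distance $\infty$ between different components. *Cut metric.* Let $\Sigma_\Omega$ be the space of measurable functions $[0,1)\to\mathcal P(\Omega)$ modulo equality almost everywhere, with the $L_1$ topology and its Borel $\sigma$-algebra. Identify $\sigma\in\Omega^n$ with $\hat\sigma\in\Sigma_\Omega$,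 the step function equal to $\delta_{\sigma_i}$ on $[(i-1)/n,i/n)$, and a probability measure $\nu$ on $\Omega^n$ with $\hat\nu=\sum_\sigma\nu(\sigma)\delta_{\hat\sigma}\in\mathcal P(\Sigma_\Omega)$. The weak cut metric on $\mathcal P(\Sigma_\Omega)$ is $$d(\mu,\nu)=\inf_{\gamma,s}\ \sup_{B,U}\ \Big\|\int_B\int_U \sigma_x-\tau_{s(x)}\,dx\,d\gamma(\sigma,\tau)\Big\|_{TV},$$ where $\gamma$ ranges over the couplings of $\mu$ and $\nu$, $s$ over the Lebesgue measure preserving maps $[0,1)\to[0,1)$, and $B\subset\Sigma_\Omega^2$, $U\subset[0,1)$ over the measurable sets. *Non-reconstruction.* Let $\nabla_\ell(G_n,x_1)$ be the $\sigma$-algebra on $\Omega^n$ generated by the values $\sigma(y)$ of all variable nodes $y$ at distance greater than $2\ell$ from $x_1$ in $G_n$. Write $\mu_{G_n\downarrow x}$ for the marginal of $\mu_{G_n}$ at $x$, $\mu_{G_n\downarrow x,y}$ for the joint marginal at $x,y$, and $\langle\cdot\rangle_{\mu_{G_n}}$ for the mean under $\mu_{G_n}$. The non-reconstruction property is $$\lim_{\ell\to\infty}\lim_{n\to\infty}\mathbb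 E\Big\langle\big\|\mu_{G_n\downarrow x_1}-\mu_{G_n\downarrow x_1}[\,\cdot\,|\nabla_\ell(G_n,x_1)]\big\|_{TV}\Big\rangle_{\mu_{G_n}}=0,$$ where the inner limit is taken to exist for every $\ell\ge1$. **Proposition.** Assume that $\lim_{n\to\infty}\mathbb E[d(\mu_{G_n},\mu)]=0$ for some $\mu\in\mathcal P(\Sigma_\Omega)$ and that the non-reconstruction property holds. Then there is $w\in\Sigma_\Omega$ such that $d(\mu,\delta_w)=0$ and $\lim_{n\to\infty}\mathbb E[d(\mu_{G_n},\delta_w)]=0$ (replica symmetry). Moreover, the two-point marginals asymptotically factorise: $$\lim_{n\to\infty}\mathbb E\big\|\mu_{G_n\downarrow x_1,x_2}-\mu_{G_n\downarrow x_1}\otimes\mu_{G_n\downarrow x_2}\big\|_{TV}=0.$$ -/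

import Mathlib

open MeasureTheory ProbabilityTheory Filter Topology
open scoped ENNReal NNReal

noncomputable section

/-! ## Step functions and the weak cut metric -/

/-- The interval `[0,1)`, carrying Lebesgue measure as its `volume`. -/
abbrev I01 : Type := Set.Ico (0 : ℝ) 1

instance : MeasureSpace I01 := Measure.Subtype.measureSpace

instance : IsProbabilityMeasure (volume : Measure I01) :=
  ⟨by rw [Measure.Subtype.volume_univ measurableSet_Ico.nullMeasurableSet]; simp⟩

/-- The space of measurable functions from `[0,1)` to the probability distributions on `Ω`
(the standard simplex of `ℝ^Ω`), up to equality almost everywhere, as a subspace of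
`L¹([0,1), ℝ^Ω)`. -/
def StepSpace.{u} (Ω : Type u) [Fintype Ω] : Type u :=
  {f : Lp (Ω → ℝ) 1 (volume : Measure I01) // ∀ᵐ x, f x ∈ stdSimplex ℝ Ω}

namespace StepSpace

variable {Ω : Type*} [Fintype Ω]

instance : MetricSpace (StepSpace Ω) := inferInstanceAs (MetricSpace (Subtype _))

/-- The Borel `σ`-algebra of the `L¹` topology. -/
instance : MeasurableSpace (StepSpace Ω) := borel _

instance : BorelSpace (StepSpace Ω) := ⟨rfl⟩

/-- The value `σ_x` (for a fixed representative of the class `σ`). -/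
def val (σ : StepSpace Ω) (x : I01) : Ω → ℝ := σ.1 x

end StepSpace

/-- Total variation norm `½ ∑ |v a|` of a finite signed measure on a finite set; for a difference
of two probability measures it is the total variation distance. -/
def tvNorm {α : Type*} [Fintype α] (v : α → ℝ) : ℝ := (∑ a, |v a|) / 2

/-- `γ` is a coupling of `μ` and `ν`. -/
def IsCoupling {X Y : Type*} [MeasurableSpace X] [MeasurableSpace Y]
    (γ : Measure (X × Y)) (μ : Measure X) (ν : Measure Y) : Prop :=
  γ.map Prod.fst = μ ∧ γ.map Prod.snd = ν

/-- The cut discrepancy of a coupling `γ` and a map `s` of `[0,1)`: the supremum over measurable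
`B` and `U` of the total variation norm of `∫_B ∫_U σ_x - τ_{s(x)} dx dγ(σ,τ)`. -/
def cutDiscrepancy {Ω : Type*} [Fintype Ω]
    (γ : Measure (StepSpace Ω × StepSpace Ω)) (s : I01 → I01) : ℝ≥0∞ :=
  ⨆ (B : Set (StepSpace Ω × StepSpace Ω)) (_ : MeasurableSet B)
    (U : Set I01) (_ : MeasurableSet U),
    ENNReal.ofReal (tvNorm
      (∫ p in B, (∫ x in U, (p.1.val x - p.2.val (s x))) ∂γ))

/-- The weak cut metric on probability measures on `StepSpace Ω`: the infimum of the cut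
discrepancy over all couplings and all measure-preserving maps `[0,1) → [0,1)`. -/
def weakCut {Ω : Type*} [Fintype Ω] (μ ν : Measure (StepSpace Ω)) : ℝ≥0∞ :=
  ⨅ (γ : Measure (StepSpace Ω × StepSpace Ω)) (_ : IsCoupling γ μ ν)
    (s : I01 → I01) (_ : MeasurePreserving s volume volume), cutDiscrepancy γ s

/-! ## Measures on discrete cubes as measures on step functions -/

/-- The index `i` (counted from `0`) such that `x ∈ [i/n, (i+1)/n)`. -/
def cellIndex (n : ℕ) [NeZero n] (x : I01) : Fin n :=
  ⟨⌊(n : ℝ) * x⌋₊, by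
    have hn : (0 : ℝ) < n := by exact_mod_cast Nat.pos_of_ne_zero (NeZero.ne n)
    rw [Nat.floor_lt (mul_nonneg hn.le x.2.1)]
    nlinarith [x.2.2]⟩

theorem measurable_cellIndex (n : ℕ) [NeZero n] : Measurable (cellIndex n) := by
  refine measurable_to_countable' fun i => ?_
  have h : cellIndex n ⁻¹' {i} = (fun x : I01 => ⌊(n : ℝ) * x⌋₊) ⁻¹' {(i : ℕ)} := by
    ext x; simp [cellIndex, Fin.ext_iff]
  rw [h]
  exact (Nat.measurable_floor.comp (by fun_prop)) (measurableSet_singleton _)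

open Classical in
/-- The step function whose value on the cell `[i/n, (i+1)/n)` is the point mass at `σ i`. -/
def hatFun {Ω : Type*} (n : ℕ) [NeZero n] (σ : Fin n → Ω) (x : I01) : Ω → ℝ :=
  Pi.single (σ (cellIndex n x)) 1

theorem memLp_hatFun {Ω : Type*} [Fintype Ω] (n : ℕ) [NeZero n] (σ : Fin n → Ω) :
    MemLp (hatFun n σ) 1 (volume : Measure I01) := by
  classical
  have hm : Measurable (hatFun n σ) :=
    (measurable_of_finite (fun i : Fin n => (Pi.single (σ i) (1 : ℝ) : Ω → ℝ))).comp
      (measurable_cellIndex n)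
  refine MemLp.of_bound hm.aestronglyMeasurable 1 (Eventually.of_forall fun x => ?_)
  refine (pi_norm_le_iff_of_nonneg zero_le_one).2 fun a => ?_
  by_cases h : a = σ (cellIndex n x)
  · subst h; simp [hatFun]
  · simp [hatFun, Pi.single_eq_of_ne h]

/-- The element of `StepSpace Ω` that represents the point `σ` of the discrete cube. -/
def hatPoint {Ω : Type*} [Fintype Ω] (n : ℕ) [NeZero n] (σ : Fin n → Ω) : StepSpace Ω :=
  ⟨(memLp_hatFun n σ).toLp, by
    classical
    filter_upwards [(memLp_hatFun n σ).coeFn_toLp] with x hx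
    rw [hx]
    exact single_mem_stdSimplex ℝ _⟩

/-- The measure `∑_σ μ(σ) δ_{σ̂}` on `StepSpace Ω` that represents the measure `μ` on the discrete
cube. -/
def hatMeasure {Ω : Type*} [Fintype Ω] [MeasurableSpace Ω] (n : ℕ) [NeZero n]
    (μ : Measure (Fin n → Ω)) : Measure (StepSpace Ω) :=
  ∑ σ : Fin n → Ω, μ {σ} • Measure.dirac (hatPoint n σ)

/-! ## Factor graphs and Gibbs measures -/

/-- A positive weight function `Ω^k → (0,∞)` of some arity `k ≥ 1`. -/
structure WeightFunction (Ω : Type*) where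
  arity : ℕ
  one_le_arity : 1 ≤ arity
  toFun : (Fin arity → Ω) → ℝ
  pos : ∀ σ, 0 < toFun σ

/-- A factor graph with variable nodes `V`, constraint nodes `F` and weight functions from `Ψ`:
each constraint node has a weight function and an ordered tuple of neighbours of matching length.
(Local finiteness is automatic for finite `F`, the case that is used.) -/
structure FactorGraph {Ω : Type*} (Ψ : Set (WeightFunction Ω)) (V F : Type*) where
  weight : F → Ψ
  nbr : (a : F) → Fin (weight a).1.arity → V

namespace FactorGraph

variable {Ω : Type*} {Ψ : Set (WeightFunction Ω)} {V F : Type*}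

/-- The product of the weights `ψ_a(σ(∂a))` over all constraint nodes `a` (for finite `F`). -/
def totalWeight (G : FactorGraph Ψ V F) (σ : V → Ω) : ℝ :=
  ∏ᶠ a : F, (G.weight a).1.toFun (fun j => σ (G.nbr a j))

/-- The partition function. -/
def partitionFunction [Fintype Ω] [Fintype V] [DecidableEq V] (G : FactorGraph Ψ V F) : ℝ :=
  ∑ σ : V → Ω, G.totalWeight σ

/-- The Gibbs measure: it gives mass `totalWeight σ / partitionFunction` to `σ`. -/
def gibbs [Fintype Ω] [MeasurableSpace Ω] [Fintype V] [DecidableEq V]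
    (G : FactorGraph Ψ V F) : Measure (V → Ω) :=
  ∑ σ : V → Ω, ENNReal.ofReal (G.totalWeight σ / G.partitionFunction) • Measure.dirac σ

theorem totalWeight_pos (G : FactorGraph Ψ V F) (σ : V → Ω) : 0 < G.totalWeight σ :=
  finprod_induction (fun r : ℝ => 0 < r) one_pos (fun _ _ => mul_pos)
    (fun a => (G.weight a).1.pos _)

instance [Fintype Ω] [Nonempty Ω] [MeasurableSpace Ω] [Fintype V] [DecidableEq V]
    (G : FactorGraph Ψ V F) : IsProbabilityMeasure G.gibbs := by
  have hZ : 0 < G.partitionFunction :=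
    Finset.sum_pos (fun σ _ => G.totalWeight_pos σ) Finset.univ_nonempty
  constructor
  simp only [gibbs, Measure.coe_finsetSum, Finset.sum_apply, Measure.smul_apply,
    measure_univ, smul_eq_mul, mul_one]
  rw [← ENNReal.ofReal_sum_of_nonneg (fun σ _ => (div_pos (G.totalWeight_pos σ) hZ).le),
    ← Finset.sum_div]
  have : (∑ σ : V → Ω, G.totalWeight σ) / G.partitionFunction = 1 := div_self hZ.ne'
  rw [this, ENNReal.ofReal_one]

/-- The bipartite graph on variable and constraint nodes. -/
def bipartite (G : FactorGraph Ψ V F) : SimpleGraph (V ⊕ F) :=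
  SimpleGraph.fromRel fun u v => ∃ (a : F) (j : Fin (G.weight a).1.arity),
    u = Sum.inl (G.nbr a j) ∧ v = Sum.inr a

/-- The variable nodes at distance greater than `2ℓ` from `x` in the bipartite graph (in
particular, all those that are not connected to `x`). -/
def farSet (G : FactorGraph Ψ V F) (ℓ : ℕ) (x : V) : Set V :=
  {y | ((2 * ℓ : ℕ) : ℕ∞) < G.bipartite.edist (Sum.inl x) (Sum.inl y)}

/-- The `σ`-algebra on `Ω^V` generated by the events `{σ y = ω}` for `ω ∈ Ω` and for the variable
nodes `y` at distance greater than `2ℓ` from `x`. -/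
@[reducible] def boundaryAlgebra (G : FactorGraph Ψ V F) (ℓ : ℕ) (x : V) : MeasurableSpace (V → Ω) :=
  MeasurableSpace.generateFrom
    {E | ∃ y ∈ G.farSet ℓ x, ∃ ω : Ω, E = {σ : V → Ω | σ y = ω}}

/-- The Gibbs average, over the boundary condition, of the total variation distance between the
Gibbs marginal of `x` and its conditional version given the boundary condition. -/
def influence [Fintype Ω] [MeasurableSpace Ω] [Fintype V] [DecidableEq V]
    (G : FactorGraph Ψ V F) (ℓ : ℕ) (x : V) : ℝ≥0∞ :=
  ∫⁻ σ, ENNReal.ofReal (tvNorm fun ω : Ω =>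
      G.gibbs.real {τ | τ x = ω} -
        (G.gibbs[Set.indicator {τ : V → Ω | τ x = ω} (fun _ => (1 : ℝ)) |
          G.boundaryAlgebra ℓ x]) σ) ∂G.gibbs

/-- The total variation distance between the joint Gibbs marginal of `x, y` and the product of the
two single marginals. -/
def pairCorrelation [Fintype Ω] [MeasurableSpace Ω] [Fintype V] [DecidableEq V]
    (G : FactorGraph Ψ V F) (x y : V) : ℝ≥0∞ :=
  ENNReal.ofReal (tvNorm fun p : Ω × Ω =>
    G.gibbs.real {τ | τ x = p.1 ∧ τ y = p.2} -
      G.gibbs.real {τ | τ x = p.1} * G.gibbs.real {τ | τ y = p.2})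

end FactorGraph

/-! ## The random factor graph -/

section RandomFactorGraph

variable {Ω : Type*} (Ψ : Set (WeightFunction Ω))

/-- The randomness of the random factor graph on `n` variable nodes: the numbers `m_ψ` of
constraint nodes of each type, and a tuple of neighbours for each potential constraint node
`(ψ, i)`, `i = 0, 1, 2, …`. -/
abbrev Sample (n : ℕ) : Type _ :=
  (Ψ → ℕ) × ((p : Ψ × ℕ) → Fin p.1.1.arity → Fin n)

/-- All `m_ψ` and all neighbour tuples are independent, `m_ψ` is Poisson with mean `n ρ_ψ`, and
each neighbour tuple is uniform. -/
def sampleLaw (ρ : Ψ → ℝ≥0) (n : ℕ) [NeZero n] : Measure (Sample Ψ n) :=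
  (Measure.infinitePi fun ψ : Ψ => poissonMeasure (n * ρ ψ)).prod
    (Measure.infinitePi fun p : Ψ × ℕ =>
      (PMF.uniformOfFintype (Fin p.1.1.arity → Fin n)).toMeasure)

variable {Ψ}

/-- The random factor graph: its constraint nodes are the pairs `(ψ, i)` with `i < m_ψ`. -/
def randomFactorGraph {n : ℕ} (S : Sample Ψ n) :
    FactorGraph Ψ (Fin n) (Σ ψ : Ψ, Fin (S.1 ψ)) where
  weight a := a.1
  nbr a := S.2 (a.1, (a.2 : ℕ))

/-- The expected weak cut distance of the Gibbs measure of the random factor graph from `μ`. -/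
def expectedCut [Fintype Ω] [MeasurableSpace Ω] (ρ : Ψ → ℝ≥0) (μ : Measure (StepSpace Ω))
    (n : ℕ) [NeZero n] : ℝ≥0∞ :=
  ∫⁻ S, weakCut (hatMeasure n (randomFactorGraph S).gibbs) μ ∂(sampleLaw Ψ ρ n)

/-- The expected influence of a random boundary condition at distance greater than `2ℓ` on the
Gibbs marginal of the first variable node. -/
def expectedInfluence [Fintype Ω] [MeasurableSpace Ω] (ρ : Ψ → ℝ≥0) (ℓ n : ℕ) [NeZero n] : ℝ≥0∞ :=
  ∫⁻ S, (randomFactorGraph S).influence ℓ (0 : Fin n) ∂(sampleLaw Ψ ρ n)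

/-- The non-reconstruction property: the iterated limit, first `n → ∞` and then `ℓ → ∞`, of the
expected influence is `0`. -/
def NonReconstruction [Fintype Ω] [MeasurableSpace Ω] (ρ : Ψ → ℝ≥0) : Prop :=
  ∃ L : ℕ → ℝ≥0∞,
    (∀ ℓ, 1 ≤ ℓ → Tendsto (fun n : ℕ => expectedInfluence ρ ℓ (n + 1)) atTop (𝓝 (L ℓ))) ∧
    Tendsto L atTop (𝓝 0)

end RandomFactorGraph

end

/-! Non-reconstruction makes spins decorrelate, and decorrelated spins leave the limit no
randomness.

If `y` lies in the far set of `x`, the events `{τ y = b}` belong to the boundary algebra. Averaging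
the conditional law of `x` over these events then bounds the pair correlation of `x, y` by the
influence on `x` (`pairCorrelation_le_influence`). Two fixed distinct variable nodes are within
distance `2ℓ` with probability tending to `0` as `n → ∞`. To see this, condition on the numbers of
constraint nodes and explore a path that never reuses a constraint node, so that each step meets
fresh randomness (`tupleLaw_reach_le`, `tendsto_countLaw_levelBound`). Only the first moment of the
arities is available, hence the truncations `min 1 _`. Relabelling symmetry carries the bound from
node `0` to all pairs, so the mean pair correlation vanishes uniformly over distinct pairs. This is
the second claim.

For the first claim, the mass of a random step function `σ̂` on any measurable set is a combination
of spin indicators with weights at most `1/n`. Its variance is thus at most the averaged absolute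
covariance, uniformly in the set. A small cut discrepancy makes the mass of `τ ~ μ` on `U` close in
`L¹` to the mass of `σ̂` on `s ⁻¹' U`, which is nearly constant (`exists_integral_abs_mass_sub_le`).
So under `μ` the mass on every `U` is almost surely constant, and second countability of `L¹` turns
this into `μ = δ_w` (`eq_dirac_of_mass_const`). For each `ε` a single good graph suffices, and a
first-moment argument supplies it. -/

noncomputable section

/-! ### Masses of step functions on measurable sets -/

namespace StepSpace

section

variable {Ω : Type*} [Fintype Ω]

theorem integrable_val (σ : StepSpace Ω) : Integrable σ.val (volume : Measure I01) :=
  L1.integrable_coeFn σ.1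

theorem val_mem (σ : StepSpace Ω) : ∀ᵐ x, σ.val x ∈ stdSimplex ℝ Ω := σ.2

/-- The integral of a step function over `U`. -/
def mass (U : Set I01) (σ : StepSpace Ω) : Ω → ℝ := ∫ x in U, σ.val x

theorem continuous_mass (U : Set I01) : Continuous (mass (Ω := Ω) U) :=
  (continuous_setIntegral (μ := volume) (E := Ω → ℝ) U).comp continuous_subtype_val

theorem eq_of_mass_eq {σ τ : StepSpace Ω} (h : ∀ U, MeasurableSet U → mass U σ = mass U τ) :
    σ = τ := by
  refine Subtype.ext (Lp.ext ?_)
  exact Integrable.ae_eq_of_forall_setIntegral_eq _ _ σ.integrable_val τ.integrable_val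
    fun U hU _ => h U hU

theorem mass_preimage {s : I01 → I01} (hs : MeasurePreserving s volume volume) {U : Set I01}
    (hU : MeasurableSet U) (σ : StepSpace Ω) :
    ∫ x in s ⁻¹' U, σ.val (s x) = mass U σ := by
  unfold mass
  conv_rhs => rw [← hs.map_eq]
  rw [setIntegral_map hU _ hs.measurable.aemeasurable]
  rw [hs.map_eq]
  exact σ.integrable_val.aestronglyMeasurable

theorem norm_mass_le (U : Set I01) (σ : StepSpace Ω) : ‖mass U σ‖ ≤ 1 := by
  have h : ∀ᵐ x ∂(volume.restrict U), ‖σ.val x‖ ≤ 1 := by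
    refine ae_restrict_of_ae ?_
    filter_upwards [σ.val_mem] with x hx
    refine (pi_norm_le_iff_of_nonneg zero_le_one).2 fun a => ?_
    rw [Real.norm_of_nonneg (hx.1 a)]
    rw [← hx.2]
    exact Finset.single_le_sum (fun i _ => hx.1 i) (Finset.mem_univ a)
  refine (norm_setIntegral_le_of_norm_le_const_ae (measure_lt_top _ _) h).trans ?_
  rw [one_mul]
  exact measureReal_le_one

instance : SecondCountableTopology (StepSpace Ω) :=
  haveI : Fact ((1 : ℝ≥0∞) ≠ ∞) := ⟨ENNReal.one_ne_top⟩
  inferInstanceAs (SecondCountableTopology (Subtype _))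

/-- There are uncountably many `U`, but the exceptional null sets are open because the mass is
continuous. By Lindelöf, countably many of them cover their union, so one null set serves all `U` at
once. Outside it all step functions have the same masses and hence coincide. -/
theorem eq_dirac_of_mass_const (μ : Measure (StepSpace Ω)) [IsProbabilityMeasure μ]
    (h : ∀ U, MeasurableSet U → ∃ c, ∀ᵐ σ ∂μ, mass U σ = c) : ∃ w, μ = Measure.dirac w := by
  choose c hc using h
  let N : {U : Set I01 // MeasurableSet U} → Set (StepSpace Ω) :=
    fun U => {σ | mass U.1 σ ≠ c U.1 U.2}
  have hN : ∀ U, IsOpen (N U) := fun U =>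
    isOpen_ne_fun (continuous_mass U.1) continuous_const
  obtain ⟨T, hT, hTU⟩ := TopologicalSpace.isOpen_iUnion_countable N hN
  have h0 : μ (⋃ U, N U) = 0 := by
    rw [← hTU]
    exact (measure_biUnion_null_iff hT).2 fun U _ => hc U.1 U.2
  have hae : ∀ᵐ σ ∂μ, ∀ U (hU : MeasurableSet U), mass U σ = c U hU := by
    have : ∀ᵐ σ ∂μ, σ ∉ ⋃ U, N U := measure_eq_zero_iff_ae_notMem.1 h0
    filter_upwards [this] with σ hσ U hU
    by_contra hne
    exact hσ (Set.mem_iUnion.2 ⟨⟨U, hU⟩, hne⟩)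
  obtain ⟨w, hw⟩ := hae.exists
  refine ⟨w, ?_⟩
  have hae' : ∀ᵐ σ ∂μ, σ = w := by
    filter_upwards [hae] with σ hσ
    exact eq_of_mass_eq fun U hU => (hσ U hU).trans (hw U hU).symm
  have := Measure.map_congr (mβ := inferInstance) (μ := μ) (f := id) (g := fun _ => w) hae'
  rw [Measure.map_id, Measure.map_const, measure_univ, one_smul] at this
  exact this

end

end StepSpace

/-! ### The total variation norm -/

theorem abs_le_two_mul_tvNorm {α : Type*} [Fintype α] (v : α → ℝ) (a : α) :
    |v a| ≤ 2 * tvNorm v := by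
  have := Finset.single_le_sum (f := fun a => |v a|) (fun i _ => abs_nonneg _) (Finset.mem_univ a)
  unfold tvNorm; linarith

theorem tvNorm_nonneg {α : Type*} [Fintype α] (v : α → ℝ) : 0 ≤ tvNorm v :=
  div_nonneg (Finset.sum_nonneg fun _ _ => abs_nonneg _) zero_le_two

/-! ### Consequences of a small cut discrepancy -/

section

variable {Ω : Type*} [Fintype Ω]

/-- Testing with the set where `f` is nonnegative and with its complement turns the supremum over
`B` in the cut discrepancy into an `L¹` bound. -/
theorem integral_abs_le_of_setIntegral_le {X : Type*} [MeasurableSpace X] {γ : Measure X}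
    {f : X → ℝ} (hf : Integrable f γ) (hfm : Measurable f) {C : ℝ}
    (h : ∀ B, MeasurableSet B → |∫ x in B, f x ∂γ| ≤ C) : ∫ x, |f x| ∂γ ≤ 2 * C := by
  have hB : MeasurableSet {x | 0 ≤ f x} := measurableSet_le measurable_const hfm
  rw [← integral_add_compl hB hf.abs]
  have h1 : ∫ x in {x | 0 ≤ f x}, |f x| ∂γ = ∫ x in {x | 0 ≤ f x}, f x ∂γ :=
    setIntegral_congr_fun hB fun x hx => abs_of_nonneg hx
  have h2 : ∫ x in {x | 0 ≤ f x}ᶜ, |f x| ∂γ = - ∫ x in {x | 0 ≤ f x}ᶜ, f x ∂γ := by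
    rw [← integral_neg]
    exact setIntegral_congr_fun hB.compl fun x hx => abs_of_neg (not_le.1 hx)
  have h3 := (le_abs_self _).trans (h _ hB)
  have h4 := (neg_le_abs _).trans (h _ hB.compl)
  rw [h1, h2]; linarith

/-- The set tested is `s ⁻¹' U`, so that the change of variables removes `s` from the second
component. The `4` is a factor `2` from the two sign sets times a factor `2` from the half in
`tvNorm`. -/
theorem integral_abs_mass_sub_le {γ : Measure (StepSpace Ω × StepSpace Ω)}
    [IsProbabilityMeasure γ] {s : I01 → I01} (hs : MeasurePreserving s volume volume) {ε : ℝ}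
    (hε : 0 ≤ ε) (h : cutDiscrepancy γ s ≤ ENNReal.ofReal ε) {U : Set I01} (hU : MeasurableSet U)
    (ω : Ω) : ∫ p, |p.1.mass (s ⁻¹' U) ω - p.2.mass U ω| ∂γ ≤ 4 * ε := by
  simp only [cutDiscrepancy, iSup_le_iff] at h
  have hkey : ∀ p : StepSpace Ω × StepSpace Ω,
      ∫ x in s ⁻¹' U, (p.1.val x - p.2.val (s x)) = p.1.mass (s ⁻¹' U) - p.2.mass U := by
    intro p
    rw [integral_sub p.1.integrable_val.integrableOn, StepSpace.mass_preimage hs hU]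
    · rfl
    · exact (hs.integrable_comp_of_integrable p.2.integrable_val).integrableOn
  have hcont : Continuous fun p : StepSpace Ω × StepSpace Ω =>
      p.1.mass (s ⁻¹' U) - p.2.mass U :=
    ((StepSpace.continuous_mass _).comp continuous_fst).sub
      ((StepSpace.continuous_mass _).comp continuous_snd)
  have hint : Integrable (fun p : StepSpace Ω × StepSpace Ω =>
      p.1.mass (s ⁻¹' U) - p.2.mass U) γ := by
    refine Integrable.of_bound hcont.aestronglyMeasurable 2 (Eventually.of_forall fun p => ?_)
    refine (norm_sub_le _ _).trans ?_
    have := StepSpace.norm_mass_le (s ⁻¹' U) p.1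
    have := StepSpace.norm_mass_le U p.2
    linarith
  have hmeas : Measurable fun p : StepSpace Ω × StepSpace Ω =>
      p.1.mass (s ⁻¹' U) ω - p.2.mass U ω :=
    ((continuous_apply ω).comp hcont).measurable
  refine (integral_abs_le_of_setIntegral_le (C := 2 * ε) (hint.eval ω) hmeas fun B hB => ?_).trans
    (by linarith)
  have h1 : ENNReal.ofReal (tvNorm (∫ p in B, (∫ x in s ⁻¹' U, (p.1.val x - p.2.val (s x))) ∂γ))
      ≤ ENNReal.ofReal ε :=
    h B hB _ (hs.measurable hU)
  rw [ENNReal.ofReal_le_ofReal_iff hε] at h1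
  simp only [hkey] at h1
  have h2 := abs_le_two_mul_tvNorm (∫ p in B, (p.1.mass (s ⁻¹' U) - p.2.mass U) ∂γ) ω
  rw [eval_integral (fun i => (hint.eval i).integrableOn)] at h2
  exact h2.trans (by linarith)

end

/-! ### Measures on discrete cubes -/

section

/-- The measure of the part of `V` in the `i`-th cell. -/
def cellVolume (n : ℕ) [NeZero n] (V : Set I01) (i : Fin n) : ℝ :=
  volume.real (V ∩ cellIndex n ⁻¹' {i})

theorem cellVolume_nonneg (n : ℕ) [NeZero n] (V : Set I01) (i : Fin n) : 0 ≤ cellVolume n V i :=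
  measureReal_nonneg

theorem cellVolume_le (n : ℕ) [NeZero n] (V : Set I01) (i : Fin n) :
    cellVolume n V i ≤ 1 / n := by
  have hn : (0 : ℝ) < n := by exact_mod_cast Nat.pos_of_ne_zero (NeZero.ne n)
  refine (measureReal_mono Set.inter_subset_right).trans ?_
  have hsub : (Subtype.val '' (cellIndex n ⁻¹' {i}) : Set ℝ) ⊆
      Set.Ico ((i : ℕ) / (n : ℝ)) (((i : ℕ) + 1) / (n : ℝ)) := by
    rintro _ ⟨x, hx, rfl⟩
    have hx' : ⌊(n : ℝ) * x⌋₊ = (i : ℕ) := congrArg Fin.val hx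
    rw [Nat.floor_eq_iff (mul_nonneg hn.le x.2.1)] at hx'
    constructor
    · rw [div_le_iff₀ hn]; linarith [hx'.1]
    · rw [lt_div_iff₀ hn]; linarith [hx'.2]
  have h1 : volume (cellIndex n ⁻¹' {i}) ≤ ENNReal.ofReal (1 / n) := by
    have h2 : (volume : Measure I01) (cellIndex n ⁻¹' {i}) =
        (volume : Measure ℝ) (Subtype.val '' (cellIndex n ⁻¹' {i})) :=
      comap_subtype_coe_apply measurableSet_Ico volume _
    rw [h2]
    refine (measure_mono hsub).trans ?_
    rw [Real.volume_Ico]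
    refine ENNReal.ofReal_le_ofReal (le_of_eq ?_)
    field_simp; ring
  exact ENNReal.toReal_le_of_le_ofReal (by positivity) h1

variable {Ω : Type*} [Fintype Ω]

theorem mass_hatPoint (n : ℕ) [NeZero n] (V : Set I01)
    (σ : Fin n → Ω) (ω : Ω) :
    (hatPoint n σ).mass V ω =
      ∑ i, cellVolume n V i * Set.indicator {τ : Fin n → Ω | τ i = ω} (fun _ => (1 : ℝ)) σ := by
  classical
  have h0 : (hatPoint n σ).mass V = ∫ x in V, hatFun n σ x :=
    integral_congr_ae (ae_restrict_of_ae (memLp_hatFun n σ).coeFn_toLp)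
  have hint : Integrable (hatFun n σ) (volume : Measure I01) :=
    memLp_one_iff_integrable.1 (memLp_hatFun n σ)
  rw [h0, eval_integral (fun i => (hint.eval i).integrableOn)]
  have h1 : ∀ x, hatFun n σ x ω = ∑ i, Set.indicator (cellIndex n ⁻¹' {i})
      (fun _ => Set.indicator {τ : Fin n → Ω | τ i = ω} (fun _ => (1 : ℝ)) σ) x := by
    intro x
    rw [Finset.sum_eq_single (cellIndex n x)]
    · simp [hatFun, Set.indicator_apply, Pi.single_apply, eq_comm]
    · intro i _ hi
      exact Set.indicator_of_notMem (fun h => hi h.symm) _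
    · simp
  simp_rw [h1]
  rw [integral_finsetSum _ fun i _ => (integrable_const _).indicator
    (measurable_cellIndex n (measurableSet_singleton i))]
  refine Finset.sum_congr rfl fun i _ => ?_
  rw [integral_indicator_const _ (measurable_cellIndex n (measurableSet_singleton i)), smul_eq_mul,
    measureReal_restrict_apply (measurable_cellIndex n (measurableSet_singleton i)),
    Set.inter_comm]
  rfl

variable [MeasurableSpace Ω] [MeasurableSingletonClass Ω]

theorem hatMeasure_eq_map (n : ℕ) [NeZero n] (P : Measure (Fin n → Ω)) :
    hatMeasure n P = P.map (hatPoint n) := by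
  classical
  have h := Measure.sum_smul_dirac P
  rw [Measure.sum_fintype] at h
  conv_rhs => rw [← h]
  rw [Measure.map_finset_sum (measurable_of_finite _).aemeasurable]
  simp [hatMeasure, Measure.map_smul, Measure.map_dirac' (measurable_of_finite (hatPoint n))]

/-- The covariance of the events `τ i = ω` and `τ j = ω`. -/
def eventCov {V : Type*} (P : Measure (V → Ω)) (ω : Ω) (i j : V) : ℝ :=
  P.real {τ | τ i = ω ∧ τ j = ω} - P.real {τ | τ i = ω} * P.real {τ | τ j = ω}

/-- Passes from a variance bound to an `L¹` bound without square roots, in place of Cauchy–Schwarz.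
-/
theorem abs_le_add_sq_div {δ : ℝ} (hδ : 0 < δ) (t : ℝ) : |t| ≤ δ + t ^ 2 / δ := by
  have h : t ^ 2 / δ * δ = t ^ 2 := div_mul_cancel₀ _ hδ.ne'
  rw [← sq_abs] at *
  nlinarith [sq_nonneg (|t| - δ), abs_nonneg t, div_nonneg (sq_nonneg |t|) hδ.le]

/-- A second-moment bound with `c` the mean of the mass. Cell volumes are at most `1/n`, whatever
`V` is, so the bound is uniform in `V`. This matters because `V` will be `s ⁻¹' U` with an
uncontrolled `s`. -/
theorem integral_abs_mass_hatPoint_sub_le (n : ℕ) [NeZero n] (P : Measure (Fin n → Ω))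
    [IsProbabilityMeasure P] (V : Set I01) (ω : Ω) {δ : ℝ} (hδ : 0 < δ) :
    ∃ c, ∫ σ, |(hatPoint n σ).mass V ω - c| ∂P ≤
      δ + (∑ i, ∑ j, |eventCov P ω i j|) / n ^ 2 / δ := by
  classical
  let X : Fin n → (Fin n → Ω) → ℝ :=
    fun i => Set.indicator {τ : Fin n → Ω | τ i = ω} (fun _ => (1 : ℝ))
  let p : Fin n → ℝ := fun i => P.real {τ | τ i = ω}
  have hset : ∀ S : Set (Fin n → Ω), MeasurableSet S := fun S => S.toFinite.measurableSet
  have hX : ∀ i, ∫ σ, X i σ ∂P = p i := fun i => integral_indicator_one (hset _)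
  have hXX : ∀ i j, ∫ σ, X i σ * X j σ ∂P = P.real {τ | τ i = ω ∧ τ j = ω} := by
    intro i j
    rw [← integral_indicator_one (hset _)]
    refine integral_congr_ae (Eventually.of_forall fun σ => ?_)
    by_cases h1 : σ i = ω <;> by_cases h2 : σ j = ω <;> simp [X, h1, h2]
  have hcov : ∀ i j, ∫ σ, (X i σ - p i) * (X j σ - p j) ∂P = eventCov P ω i j := by
    intro i j
    have : ∀ σ, (X i σ - p i) * (X j σ - p j) =
      X i σ * X j σ - p j * X i σ - p i * X j σ + p i * p j := fun σ => by ring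
    simp_rw [this]
    rw [integral_add .of_finite .of_finite, integral_sub .of_finite .of_finite,
      integral_sub .of_finite .of_finite, hXX, integral_const_mul, integral_const_mul, hX, hX]
    simp [eventCov, p]; ring
  refine ⟨∑ i, cellVolume n V i * p i, ?_⟩
  have h1 : ∀ σ, (hatPoint n σ).mass V ω - ∑ i, cellVolume n V i * p i =
      ∑ i, cellVolume n V i * (X i σ - p i) := by
    intro σ
    rw [mass_hatPoint n V, ← Finset.sum_sub_distrib]
    exact Finset.sum_congr rfl fun i _ => by ring
  simp_rw [h1]
  refine (integral_mono .of_finite .of_finite fun σ => abs_le_add_sq_div hδ _).trans ?_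
  rw [integral_add .of_finite .of_finite, integral_div]
  simp only [integral_const, probReal_univ, smul_eq_mul, one_mul]
  have h2 : ∫ σ, (∑ i, cellVolume n V i * (X i σ - p i)) ^ 2 ∂P =
      ∑ i, ∑ j, cellVolume n V i * cellVolume n V j * eventCov P ω i j := by
    simp_rw [sq, Finset.sum_mul_sum]
    rw [integral_finsetSum _ fun i _ => .of_finite]
    refine Finset.sum_congr rfl fun i _ => ?_
    rw [integral_finsetSum _ fun i _ => .of_finite]
    refine Finset.sum_congr rfl fun j _ => ?_
    rw [← hcov, ← integral_const_mul]
    exact integral_congr_ae (Eventually.of_forall fun σ => by ring)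
  rw [h2]
  gcongr
  rw [Finset.sum_div]
  refine Finset.sum_le_sum fun i _ => ?_
  rw [Finset.sum_div]
  refine Finset.sum_le_sum fun j _ => ?_
  have hi := cellVolume_le n V i
  have hj := cellVolume_le n V j
  have hi0 := cellVolume_nonneg n V i
  have hj0 := cellVolume_nonneg n V j
  calc _ ≤ |cellVolume n V i * cellVolume n V j * eventCov P ω i j| := le_abs_self _
    _ = cellVolume n V i * cellVolume n V j * |eventCov P ω i j| := by
      rw [abs_mul, abs_of_nonneg (mul_nonneg hi0 hj0)]
    _ ≤ (1 / n * (1 / n)) * |eventCov P ω i j| := by gcongr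
    _ = _ := by field_simp

theorem exists_integral_abs_mass_sub_le {n : ℕ} [NeZero n] {P : Measure (Fin n → Ω)}
    [IsProbabilityMeasure P] {μ : Measure (StepSpace Ω)} {ε δ : ℝ} (hε : 0 < ε) (hδ : 0 < δ)
    (h : weakCut (hatMeasure n P) μ < ENNReal.ofReal ε) {U : Set I01} (hU : MeasurableSet U)
    (ω : Ω) : ∃ c, ∫ τ, |τ.mass U ω - c| ∂μ ≤
      4 * ε + δ + (∑ i, ∑ j, |eventCov P ω i j|) / n ^ 2 / δ := by
  unfold weakCut at h
  simp only [iInf_lt_iff] at h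
  obtain ⟨γ, ⟨h1, h2⟩, s, hs, hlt⟩ := h
  rw [hatMeasure_eq_map] at h1
  have hPm : IsProbabilityMeasure (P.map (hatPoint n)) :=
    Measure.isProbabilityMeasure_map (measurable_of_finite _).aemeasurable
  -- `IsCoupling` constrains only the marginals; the total mass is read off from the first one.
  have hγ : IsProbabilityMeasure γ := by
    constructor
    rw [← h1] at hPm
    have := hPm.measure_univ
    rwa [Measure.map_apply measurable_fst MeasurableSet.univ, Set.preimage_univ] at this
  obtain ⟨c, hc⟩ := integral_abs_mass_hatPoint_sub_le n P _ ω hδ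
  refine ⟨c, ?_⟩
  have hm : ∀ V : Set I01, Continuous fun σ : StepSpace Ω => σ.mass V ω := fun V =>
    (continuous_apply ω).comp (StepSpace.continuous_mass V)
  have hb : ∀ (V : Set I01) (σ : StepSpace Ω), |σ.mass V ω| ≤ 1 := fun V σ =>
    (norm_le_pi_norm (σ.mass V) ω).trans (StepSpace.norm_mass_le V σ)
  have hc1 : ∫ σ, |(hatPoint n σ).mass (s ⁻¹' U) ω - c| ∂P =
      ∫ q, |q.1.mass (s ⁻¹' U) ω - c| ∂γ := by
    have hcont : Continuous fun σ : StepSpace Ω => |σ.mass (s ⁻¹' U) ω - c| :=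
      ((hm _).sub continuous_const).abs
    rw [← integral_map (φ := hatPoint n) (f := fun σ => |σ.mass (s ⁻¹' U) ω - c|)
      (measurable_of_finite _).aemeasurable hcont.aestronglyMeasurable, ← h1,
      integral_map measurable_fst.aemeasurable hcont.aestronglyMeasurable]
  have hc2 : ∫ τ, |τ.mass U ω - c| ∂μ = ∫ q, |q.2.mass U ω - c| ∂γ := by
    have hcont : Continuous fun σ : StepSpace Ω => |σ.mass U ω - c| :=
      ((hm _).sub continuous_const).abs
    rw [← h2, integral_map measurable_snd.aemeasurable hcont.aestronglyMeasurable]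
  have hd := integral_abs_mass_sub_le hs hε.le hlt.le hU ω
  rw [hc2]
  rw [hc1] at hc
  have i1 : Integrable (fun q : StepSpace Ω × StepSpace Ω => |q.1.mass (s ⁻¹' U) ω - q.2.mass U ω|)
      γ := by
    refine Integrable.of_bound ((((hm _).comp continuous_fst).sub
      ((hm _).comp continuous_snd)).abs.aestronglyMeasurable) 2 (Eventually.of_forall fun q => ?_)
    rw [Real.norm_eq_abs, abs_abs]
    exact (abs_sub _ _).trans (by linarith [hb (s ⁻¹' U) q.1, hb U q.2])
  have i2 : ∀ (V : Set I01) (g : StepSpace Ω × StepSpace Ω → StepSpace Ω), Continuous g →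
      Integrable (fun q => |(g q).mass V ω - c|) γ := by
    intro V g hg
    refine Integrable.of_bound ((((hm _).comp hg).sub continuous_const).abs.aestronglyMeasurable)
      (1 + |c|) (Eventually.of_forall fun q => ?_)
    rw [Real.norm_eq_abs, abs_abs]
    exact (abs_sub _ _).trans (by linarith [hb V (g q)])
  have h3 : ∫ q, |q.2.mass U ω - c| ∂γ ≤
      ∫ q, (|q.1.mass (s ⁻¹' U) ω - q.2.mass U ω| + |q.1.mass (s ⁻¹' U) ω - c|) ∂γ := by
    refine integral_mono (i2 U _ continuous_snd) (i1.add (i2 _ _ continuous_fst)) fun q => ?_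
    have := abs_sub_le (q.2.mass U ω) (q.1.mass (s ⁻¹' U) ω) c
    rwa [abs_sub_comm (q.2.mass U ω) (q.1.mass (s ⁻¹' U) ω)] at this
  rw [integral_add i1 (i2 _ _ continuous_fst)] at h3
  linarith

/-- A probability measure is a point mass if it can be approximated in the weak cut metric by
measures on discrete cubes with asymptotically vanishing pair correlations. -/
theorem eq_dirac_of_forall_exists_weakCut_lt (μ : Measure (StepSpace Ω)) [IsProbabilityMeasure μ]
    (h : ∀ ε : ℝ, 0 < ε → ∃ (n : ℕ) (_ : NeZero n) (P : Measure (Fin n → Ω)),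
      IsProbabilityMeasure P ∧ weakCut (hatMeasure n P) μ < ENNReal.ofReal ε ∧
        ∀ ω, ∑ i, ∑ j, |eventCov P ω i j| ≤ ε * n ^ 2) :
    ∃ w, μ = Measure.dirac w := by
  refine StepSpace.eq_dirac_of_mass_const μ fun U hU => ?_
  refine ⟨fun ω => ∫ τ, τ.mass U ω ∂μ, ?_⟩
  have hcont : ∀ ω, Continuous fun σ : StepSpace Ω => σ.mass U ω := fun ω =>
    (continuous_apply ω).comp (StepSpace.continuous_mass U)
  have hint : ∀ ω, Integrable (fun σ : StepSpace Ω => σ.mass U ω) μ := fun ω =>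
    Integrable.of_bound (hcont ω).aestronglyMeasurable 1 (Eventually.of_forall fun σ =>
      (norm_le_pi_norm (σ.mass U) ω).trans (StepSpace.norm_mass_le U σ))
  have key : ∀ ω, ∫ τ, |τ.mass U ω - ∫ τ, τ.mass U ω ∂μ| ∂μ ≤ 0 := by
    intro ω
    refine le_of_forall_pos_le_add fun η hη => ?_
    rw [zero_add]
    -- With this choice the three error terms are at most `η/4`, `η/8` and `η/8`, in total `η/2`.
    -- Replacing `c` by the mean costs another `η/2`.
    obtain ⟨n, hn, P, hP, hw, hcov⟩ := h (min (η / 16) ((η / 8) ^ 2)) (by positivity)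
    obtain ⟨c, hc⟩ := exists_integral_abs_mass_sub_le (by positivity) (δ := η / 8) (by positivity)
      hw hU ω
    have hn' : (0 : ℝ) < n := by exact_mod_cast Nat.pos_of_ne_zero (NeZero.ne n)
    have h1 : (∑ i, ∑ j, |eventCov P ω i j|) / n ^ 2 / (η / 8) ≤ η / 8 := by
      rw [div_le_iff₀ (by positivity), div_le_iff₀ (by positivity)]
      refine (hcov ω).trans ?_
      rw [← sq]
      exact mul_le_mul_of_nonneg_right (min_le_right _ _) (by positivity)
    have h2 := min_le_left (η / 16) ((η / 8) ^ 2)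
    have h3 : ∫ τ, |τ.mass U ω - c| ∂μ ≤ η / 2 := by linarith
    have i1 : Integrable (fun τ : StepSpace Ω => τ.mass U ω - c) μ :=
      (hint ω).sub (integrable_const c)
    have h4 : |c - ∫ τ, τ.mass U ω ∂μ| ≤ η / 2 := by
      have : (∫ τ, τ.mass U ω ∂μ) - c = ∫ τ, (τ.mass U ω - c) ∂μ := by
        rw [integral_sub (hint ω) (integrable_const c)]; simp
      rw [abs_sub_comm, this]
      exact abs_integral_le_integral_abs.trans h3
    calc _ ≤ ∫ τ, (|τ.mass U ω - c| + |c - ∫ τ, τ.mass U ω ∂μ|) ∂μ :=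
          integral_mono ((hint ω).sub (integrable_const _)).abs
            (i1.abs.add (integrable_const _)) fun τ => abs_sub_le _ _ _
      _ = (∫ τ, |τ.mass U ω - c| ∂μ) + |c - ∫ τ, τ.mass U ω ∂μ| := by
        rw [integral_add i1.abs (integrable_const _)]; simp
      _ ≤ η := by linarith
  have hae : ∀ ω, ∀ᵐ τ ∂μ, τ.mass U ω = ∫ τ, τ.mass U ω ∂μ := by
    intro ω
    have i0 := ((hint ω).sub (integrable_const (∫ τ, τ.mass U ω ∂μ))).abs
    have h0 := le_antisymm (key ω) (integral_nonneg fun τ => abs_nonneg _)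
    have := (integral_eq_zero_iff_of_nonneg (fun τ => abs_nonneg _) i0).1 h0
    filter_upwards [this] with τ hτ
    exact sub_eq_zero.1 (abs_eq_zero.1 hτ)
  filter_upwards [ae_all_iff.2 hae] with τ hτ
  exact funext hτ

end

/-! ### Pair correlations and influences -/

namespace FactorGraph

section

variable {Ω : Type*} {Ψ : Set (WeightFunction Ω)} {V F : Type*}

/-- The factor graph with the variable nodes renamed. -/
def relabel (G : FactorGraph Ψ V F) (e : Equiv.Perm V) : FactorGraph Ψ V F where
  weight := G.weight
  nbr a j := e (G.nbr a j)

variable [Fintype Ω] [Fintype V] [DecidableEq V]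

theorem partitionFunction_relabel (G : FactorGraph Ψ V F) (e : Equiv.Perm V) :
    (G.relabel e).partitionFunction = G.partitionFunction :=
  Equiv.sum_comp (e.symm.arrowCongr (Equiv.refl Ω)) G.totalWeight

variable [MeasurableSpace Ω]

theorem ofReal_abs_eventCov_le (G : FactorGraph Ψ V F) (ω : Ω) (x y : V) :
    ENNReal.ofReal |eventCov G.gibbs ω x y| ≤ 2 * G.pairCorrelation x y := by
  unfold pairCorrelation eventCov
  rw [← ENNReal.ofReal_ofNat 2, ← ENNReal.ofReal_mul zero_le_two]
  exact ENNReal.ofReal_le_ofReal (abs_le_two_mul_tvNorm (fun p : Ω × Ω =>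
    G.gibbs.real {τ | τ x = p.1 ∧ τ y = p.2} -
      G.gibbs.real {τ | τ x = p.1} * G.gibbs.real {τ | τ y = p.2}) (ω, ω))

variable [MeasurableSingletonClass Ω]

open Classical in
theorem gibbs_apply (G : FactorGraph Ψ V F) (E : Set (V → Ω)) :
    G.gibbs E = ∑ σ : V → Ω,
      ENNReal.ofReal (G.totalWeight σ / G.partitionFunction) * E.indicator 1 σ := by
  simp [gibbs, Measure.dirac_apply' _ E.toFinite.measurableSet]

/-- The weight of `σ` in the relabelled graph is by definition the original weight of `σ ∘ e`, so
this is a reindexing of the sum over configurations. -/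
theorem gibbs_real_relabel (G : FactorGraph Ψ V F) (e : Equiv.Perm V) (E : Set (V → Ω)) :
    (G.relabel e).gibbs.real {τ | τ ∘ e ∈ E} = G.gibbs.real E := by
  rw [measureReal_def, measureReal_def, gibbs_apply, gibbs_apply, partitionFunction_relabel]
  congr 1
  exact Equiv.sum_comp (e.symm.arrowCongr (Equiv.refl Ω)) fun σ =>
    ENNReal.ofReal (G.totalWeight σ / G.partitionFunction) * E.indicator 1 σ

theorem pairCorrelation_relabel (G : FactorGraph Ψ V F) (e : Equiv.Perm V) (x y : V) :
    (G.relabel e).pairCorrelation (e x) (e y) = G.pairCorrelation x y := by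
  unfold pairCorrelation
  congr 2
  funext p
  rw [← gibbs_real_relabel G e {τ | τ x = p.1 ∧ τ y = p.2},
    ← gibbs_real_relabel G e {τ | τ x = p.1}, ← gibbs_real_relabel G e {τ | τ y = p.2}]
  rfl

theorem pairCorrelation_le_one [Nonempty Ω] (G : FactorGraph Ψ V F) (x y : V) :
    G.pairCorrelation x y ≤ 1 := by
  classical
  have hset : ∀ S : Set (V → Ω), MeasurableSet S := fun S => S.toFinite.measurableSet
  have h1 : ∀ z, ∑ a, G.gibbs.real {τ : V → Ω | τ z = a} = 1 := by
    intro z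
    have := sum_measureReal_preimage_singleton (μ := G.gibbs) (f := fun τ : V → Ω => τ z)
      Finset.univ (fun a _ => hset _)
    simpa only [Finset.coe_univ, Set.preimage_univ, probReal_univ] using! this
  have h2 : ∑ p : Ω × Ω, G.gibbs.real {τ : V → Ω | τ x = p.1 ∧ τ y = p.2} = 1 := by
    have := sum_measureReal_preimage_singleton (μ := G.gibbs) (f := fun τ : V → Ω => (τ x, τ y))
      Finset.univ (fun a _ => hset _)
    simp only [Finset.coe_univ, Set.preimage_univ, probReal_univ] at this
    rw [← this]
    refine Finset.sum_congr rfl fun p _ => ?_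
    congr 1
    ext τ
    simp [Prod.ext_iff]
  have h3 : ∑ p : Ω × Ω, G.gibbs.real {τ : V → Ω | τ x = p.1} *
      G.gibbs.real {τ : V → Ω | τ y = p.2} = 1 := by
    rw [Fintype.sum_prod_type]
    simp_rw [← Finset.mul_sum]
    rw [← Finset.sum_mul, h1, h1, one_mul]
  unfold pairCorrelation
  rw [ENNReal.ofReal_le_one, tvNorm, div_le_one two_pos]
  calc _ ≤ ∑ p : Ω × Ω, (G.gibbs.real {τ : V → Ω | τ x = p.1 ∧ τ y = p.2} +
        G.gibbs.real {τ : V → Ω | τ x = p.1} * G.gibbs.real {τ : V → Ω | τ y = p.2}) := by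
        refine Finset.sum_le_sum fun p _ => ?_
        refine (abs_sub _ _).trans (le_of_eq ?_)
        rw [abs_of_nonneg measureReal_nonneg, abs_of_nonneg (by positivity)]
    _ = 2 := by rw [Finset.sum_add_distrib, h2, h3]; norm_num

/-- As `{τ y = b}` is boundary measurable, integrating the conditional probability of `{τ x = a}`
over it gives the joint probability. The correlation at `(a, b)` is thus, up to sign, the integral
of `D a` over `{τ y = b}`. Taking absolute values inside and summing over `b` yields the mean of `|D
a|`. -/
theorem pairCorrelation_le_influence [Nonempty Ω] (G : FactorGraph Ψ V F) {ℓ : ℕ} {x y : V}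
    (hy : y ∈ G.farSet ℓ x) : G.pairCorrelation x y ≤ G.influence ℓ x := by
  classical
  have hset : ∀ S : Set (V → Ω), MeasurableSet S := fun S => S.toFinite.measurableSet
  have hm : G.boundaryAlgebra ℓ x ≤ MeasurableSpace.pi := fun S _ => hset S
  have hfin : ∀ f : (V → Ω) → ℝ, Integrable f G.gibbs := fun f => .of_finite
  let c : Ω → (V → Ω) → ℝ := fun a =>
    G.gibbs[Set.indicator {τ : V → Ω | τ x = a} (fun _ => (1 : ℝ)) | G.boundaryAlgebra ℓ x]
  let D : Ω → (V → Ω) → ℝ := fun a σ => G.gibbs.real {τ | τ x = a} - c a σ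
  have hinf : G.influence ℓ x = ENNReal.ofReal (∫ σ, tvNorm (fun a => D a σ) ∂G.gibbs) := by
    rw [ofReal_integral_eq_lintegral_ofReal (hfin _)
      (Eventually.of_forall fun σ => tvNorm_nonneg _)]
    rfl
  rw [hinf, pairCorrelation]
  refine ENNReal.ofReal_le_ofReal ?_
  unfold tvNorm
  rw [integral_div]
  refine div_le_div_of_nonneg_right ?_ zero_le_two
  rw [integral_finsetSum _ fun a _ => hfin _, Fintype.sum_prod_type]
  refine Finset.sum_le_sum fun a _ => ?_
  have hE : ∀ b, MeasurableSet[G.boundaryAlgebra ℓ x] {τ : V → Ω | τ y = b} := fun b =>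
    MeasurableSpace.measurableSet_generateFrom ⟨y, hy, b, rfl⟩
  have hpart : ∫ σ, |D a σ| ∂G.gibbs = ∑ b, ∫ σ in {τ : V → Ω | τ y = b}, |D a σ| ∂G.gibbs := by
    rw [← integral_iUnion_fintype (fun b => hset _) ?_ fun b => (hfin _).integrableOn]
    · have : (⋃ b, {τ : V → Ω | τ y = b}) = Set.univ := by ext; simp
      rw [this, setIntegral_univ]
    · intro b b' hb
      refine Set.disjoint_left.2 fun τ h1 h2 => hb ?_
      exact (h1 : τ y = b).symm.trans h2
  rw [hpart]
  refine Finset.sum_le_sum fun b _ => ?_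
  have hcond : ∫ σ in {τ : V → Ω | τ y = b}, c a σ ∂G.gibbs =
      G.gibbs.real {τ | τ x = a ∧ τ y = b} := by
    rw [setIntegral_condExp hm (hfin _) (hE b), integral_indicator_const _ (hset _),
      measureReal_restrict_apply (hset _), smul_eq_mul, mul_one]
    rfl
  have hD : ∫ σ in {τ : V → Ω | τ y = b}, D a σ ∂G.gibbs =
      -(G.gibbs.real {τ | τ x = a ∧ τ y = b} -
        G.gibbs.real {τ | τ x = a} * G.gibbs.real {τ | τ y = b}) := by
    rw [integral_sub (integrable_const _) (hfin _).integrableOn, hcond, setIntegral_const,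
      smul_eq_mul]
    ring
  have := abs_integral_le_integral_abs (μ := G.gibbs.restrict {τ : V → Ω | τ y = b}) (f := D a)
  rwa [hD, abs_neg] at this

end

end FactorGraph

/-! ### Uniform tuples -/

section

variable {n : ℕ} [NeZero n]

/-- The uniform distribution on the `k`-tuples of elements of `Fin n`. -/
abbrev uniformTuple (k n : ℕ) [NeZero n] : Measure (Fin k → Fin n) :=
  (PMF.uniformOfFintype (Fin k → Fin n)).toMeasure

theorem uniformTuple_singleton (k : ℕ) (t : Fin k → Fin n) :
    uniformTuple k n {t} = ((n : ℝ≥0∞) ^ k)⁻¹ := by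
  rw [PMF.toMeasure_apply_singleton _ _ (measurableSet_singleton _), PMF.uniformOfFintype_apply]
  simp

theorem uniformTuple_map_perm (k : ℕ) (e : Equiv.Perm (Fin n)) :
    (uniformTuple k n).map (fun t j => e (t j)) = uniformTuple k n := by
  refine Measure.ext_of_singleton fun t => ?_
  rw [Measure.map_apply (measurable_of_finite _) (measurableSet_singleton _),
    uniformTuple_singleton]
  have : (fun (t : Fin k → Fin n) j => e (t j)) ⁻¹' {t} = {fun j => e.symm (t j)} := by
    ext s
    simp [funext_iff, Equiv.eq_symm_apply]
  rw [this, uniformTuple_singleton]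

theorem uniformTuple_eq_infinitePi (k : ℕ) :
    uniformTuple k n =
      Measure.infinitePi fun _ : Fin k => (PMF.uniformOfFintype (Fin n)).toMeasure := by
  refine Measure.ext_of_singleton fun t => ?_
  rw [uniformTuple_singleton, Measure.infinitePi_singleton_of_fintype]
  simp [ENNReal.inv_pow]

theorem uniformTuple_eval (k : ℕ) (i : Fin k) (x : Fin n) :
    uniformTuple k n {t | t i = x} = (n : ℝ≥0∞)⁻¹ := by
  have : {t : Fin k → Fin n | t i = x} = Set.pi ({i} : Finset (Fin k)) fun _ => {x} := by
    ext; simp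
  rw [this, uniformTuple_eq_infinitePi, Measure.infinitePi_pi _ fun _ _ => measurableSet_singleton _]
  simp

theorem uniformTuple_eval_eval_le (k : ℕ) (i j : Fin k) {x y : Fin n} (hxy : x ≠ y) :
    uniformTuple k n {t | t i = x ∧ t j = y} ≤ (n : ℝ≥0∞)⁻¹ * (n : ℝ≥0∞)⁻¹ := by
  classical
  by_cases hij : i = j
  · subst hij
    have : {t : Fin k → Fin n | t i = x ∧ t i = y} = ∅ := by
      ext t
      simp only [Set.mem_ofPred_eq, Set.mem_empty_iff_false, iff_false, not_and]
      exact fun h h' => hxy (h.symm.trans h')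
    rw [this, measure_empty]
    exact zero_le
  · have : {t : Fin k → Fin n | t i = x ∧ t j = y} =
        Set.pi ({i, j} : Finset (Fin k)) fun l => if l = i then {x} else {y} := by
      ext
      simp [Ne.symm hij]
    rw [this, uniformTuple_eq_infinitePi, Measure.infinitePi_pi _
      fun l _ => (Set.toFinite _).measurableSet, Finset.prod_pair hij]
    simp [Ne.symm hij]

end

/-! ### Reachability -/

section

variable {I V : Type*} [DecidableEq I] {k : I → ℕ}

/-- `y` can be reached from `x` in at most `ℓ` steps, each of which uses a constraint node from `A`
that was not used before. -/
def Reach (nb : (a : I) → Fin (k a) → V) : ℕ → Finset I → V → V → Prop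
  | 0, _, x, y => x = y
  | ℓ + 1, A, x, y => x = y ∨ ∃ a ∈ A, ∃ i j, nb a i = x ∧ Reach nb ℓ (A.erase a) (nb a j) y

theorem Reach.congr {nb nb' : (a : I) → Fin (k a) → V} {ℓ : ℕ} {A : Finset I} {x y : V}
    (h : ∀ a ∈ A, nb a = nb' a) (hr : Reach nb ℓ A x y) : Reach nb' ℓ A x y := by
  induction ℓ generalizing A x with
  | zero => exact hr
  | succ ℓ ih =>
    obtain hr | ⟨a, ha, i, j, hi, hr⟩ := hr
    · exact Or.inl hr
    · refine Or.inr ⟨a, ha, i, j, by rw [← h a ha, hi], ?_⟩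
      rw [← h a ha]
      exact ih (fun b hb => h b (Finset.mem_of_mem_erase hb)) hr

theorem Reach.refl (nb : (a : I) → Fin (k a) → V) (ℓ : ℕ) (A : Finset I) (x : V) :
    Reach nb ℓ A x x := by
  cases ℓ with
  | zero => rfl
  | succ ℓ => exact Or.inl rfl

end

/-- Reduces events determined by finitely many tuples to subsets of a finite product, where
measurability is automatic. -/
theorem eq_preimage_restrict {I : Type*} {X : I → Type*} (A : Finset I) (R : Set ((a : I) → X a))
    (h : ∀ nb nb', (∀ a ∈ A, nb a = nb' a) → nb ∈ R → nb' ∈ R) :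
    R = A.restrict ⁻¹' (A.restrict '' R) := by
  refine (Set.subset_preimage_image _ _).antisymm ?_
  rintro nb ⟨nb', hnb', heq⟩
  exact h nb' nb (fun a ha => congrFun heq ⟨a, ha⟩) hnb'

section

variable {I : Type*} {k : I → ℕ} {n : ℕ} [NeZero n]

/-- The law of independent uniform neighbour tuples. -/
abbrev tupleLaw (k : I → ℕ) (n : ℕ) [NeZero n] : Measure ((a : I) → Fin (k a) → Fin n) :=
  Measure.infinitePi fun a => uniformTuple (k a) n

theorem tupleLaw_inter (a : I) (B : Finset I) (ha : a ∉ B) (S : Set (Fin (k a) → Fin n))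
    (R : Set ((a : I) → Fin (k a) → Fin n))
    (h : ∀ nb nb', (∀ a ∈ B, nb a = nb' a) → nb ∈ R → nb' ∈ R) :
    tupleLaw k n {nb | nb a ∈ S ∧ nb ∈ R} = uniformTuple (k a) n S * tupleLaw k n R := by
  have hind := (iIndepFun_infinitePi (P := fun a => uniformTuple (k a) n)
    (X := fun _ t => t) fun _ => measurable_id).indepFun_finset {a} B
      (Finset.disjoint_singleton_left.2 ha) fun i => measurable_pi_apply i
  have h1 := hind.measure_inter_preimage_eq_mul {f | f ⟨a, Finset.mem_singleton_self a⟩ ∈ S}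
    (B.restrict '' R) (Set.toFinite _).measurableSet (Set.toFinite _).measurableSet
  have h2 : (fun (nb : (a : I) → Fin (k a) → Fin n) (i : B) => nb i) ⁻¹' (B.restrict '' R) = R :=
    (eq_preimage_restrict B R h).symm
  rw [h2] at h1
  refine h1.trans ?_
  congr 1
  have h3 := (measurePreserving_eval_infinitePi (fun a => uniformTuple (k a) n) a).measure_preimage
    (Set.toFinite S).measurableSet.nullMeasurableSet
  exact h3

variable [DecidableEq I]

/-- The recursive upper bound for the probability that two given variable nodes are connected by
at most `ℓ` steps through the constraint nodes in `A`. -/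
def reachBound (k : I → ℕ) (n : ℕ) (A : Finset I) : ℕ → ℝ≥0∞
  | 0 => 0
  | ℓ + 1 => ∑ a ∈ A, k a * (n : ℝ≥0∞)⁻¹ *
      min 1 (k a * ((n : ℝ≥0∞)⁻¹ + reachBound k n A ℓ))

/-- Expose the first constraint node `a`, whose slot `i` hits `x` with probability `1/n`. Slot `j`
then either hits `y` at once, jointly with probability at most `1/n²`, or hits some `z ≠ y`. In the
latter case the continuation uses only `B.erase a`, so it is independent of the tuple at `a` and the
induction hypothesis applies. Ignoring the continuation gives the other side of the `min`. The bound
is stated for all `B ⊆ A` because `B` shrinks while `A` stays fixed. -/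
theorem tupleLaw_reach_le (A : Finset I) (ℓ : ℕ) (B : Finset I) (hB : B ⊆ A) {x y : Fin n}
    (hxy : x ≠ y) : tupleLaw k n {nb | Reach nb ℓ B x y} ≤ reachBound k n A ℓ := by
  induction ℓ generalizing B x with
  | zero => simp [Reach, hxy]
  | succ ℓ ih =>
    have hsub : {nb : (a : I) → Fin (k a) → Fin n | Reach nb (ℓ + 1) B x y} ⊆
        ⋃ a ∈ B, ⋃ i : Fin (k a), {nb | nb a i = x ∧ ∃ j, Reach nb ℓ (B.erase a) (nb a j) y} := by
      rintro nb (h | ⟨a, ha, i, j, hi, hr⟩)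
      · exact absurd h hxy
      · simp only [Set.mem_iUnion]
        exact ⟨a, ha, i, hi, j, hr⟩
    refine (measure_mono hsub).trans ((measure_biUnion_finset_le _ _).trans ?_)
    refine (Finset.sum_le_sum_of_subset hB).trans' (Finset.sum_le_sum fun a ha => ?_)
    refine (measure_iUnion_le _).trans ?_
    rw [tsum_fintype]
    have key : ∀ i : Fin (k a), tupleLaw k n
        {nb | nb a i = x ∧ ∃ j, Reach nb ℓ (B.erase a) (nb a j) y} ≤
        (n : ℝ≥0∞)⁻¹ * min 1 (k a * ((n : ℝ≥0∞)⁻¹ + reachBound k n A ℓ)) := by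
      intro i
      have h1 : tupleLaw k n {nb | nb a i = x} = (n : ℝ≥0∞)⁻¹ := by
        rw [← uniformTuple_eval (k a) i x]
        exact (measurePreserving_eval_infinitePi (fun a => uniformTuple (k a) n)
          a).measure_preimage (Set.toFinite {t : Fin (k a) → Fin n |
            t i = x}).measurableSet.nullMeasurableSet
      rw [mul_min, mul_one]
      refine le_min ((measure_mono fun nb h => h.1).trans h1.le) ?_
      have hsub' : {nb : (a : I) → Fin (k a) → Fin n |
            nb a i = x ∧ ∃ j, Reach nb ℓ (B.erase a) (nb a j) y} ⊆
          ⋃ j : Fin (k a), {nb | nb a i = x ∧ Reach nb ℓ (B.erase a) (nb a j) y} := by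
        rintro nb ⟨h, j, hj⟩
        exact Set.mem_iUnion.2 ⟨j, h, hj⟩
      refine (measure_mono hsub').trans ((measure_iUnion_le _).trans ?_)
      rw [tsum_fintype]
      have hj : ∀ j : Fin (k a), tupleLaw k n
          {nb | nb a i = x ∧ Reach nb ℓ (B.erase a) (nb a j) y} ≤
          (n : ℝ≥0∞)⁻¹ * ((n : ℝ≥0∞)⁻¹ + reachBound k n A ℓ) := by
        intro j
        have hsub'' : {nb : (a : I) → Fin (k a) → Fin n |
              nb a i = x ∧ Reach nb ℓ (B.erase a) (nb a j) y} ⊆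
            {nb | nb a ∈ {t | t i = x ∧ t j = y} ∧ nb ∈ Set.univ} ∪
            ⋃ z ∈ Finset.univ.erase y, {nb | nb a ∈ {t | t i = x ∧ t j = z} ∧
              nb ∈ {nb | Reach nb ℓ (B.erase a) z y}} := by
          rintro nb ⟨h, hr⟩
          by_cases hz : nb a j = y
          · exact Or.inl ⟨⟨h, hz⟩, trivial⟩
          · refine Or.inr ?_
            simp only [Set.mem_iUnion]
            exact ⟨nb a j, by simp [hz], ⟨h, rfl⟩, hr⟩
        refine (measure_mono hsub'').trans ((measure_union_le _ _).trans ?_)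
        rw [mul_add]
        refine add_le_add ?_ ?_
        · rw [tupleLaw_inter a ∅ (by simp) _ _ fun _ _ _ h => h, measure_univ, mul_one]
          exact uniformTuple_eval_eval_le _ _ _ hxy
        · refine (measure_biUnion_finset_le _ _).trans ?_
          calc _ ≤ ∑ z ∈ Finset.univ.erase y,
                uniformTuple (k a) n {t | t i = x ∧ t j = z} * reachBound k n A ℓ := by
                refine Finset.sum_le_sum fun z hz => ?_
                rw [tupleLaw_inter a (B.erase a) (by simp) _ _ fun _ _ h hr => hr.congr h]
                gcongr
                exact ih _ ((Finset.erase_subset _ _).trans hB) (Finset.ne_of_mem_erase hz)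
            _ ≤ (∑ z, uniformTuple (k a) n {t | t i = x ∧ t j = z}) * reachBound k n A ℓ := by
                rw [← Finset.sum_mul]
                gcongr
                exact Finset.erase_subset _ _
            _ = _ := by
                congr 1
                rw [← uniformTuple_eval (k a) i x, ← measure_biUnion_finset]
                · congr 1
                  ext t
                  simp
                · intro z _ z' _ hzz
                  refine Set.disjoint_left.2 fun t h1 h2 => hzz (h1.2.symm.trans h2.2)
                · exact fun z _ => (Set.toFinite _).measurableSet
      refine (Finset.sum_le_sum fun j _ => hj j).trans (le_of_eq ?_)
      simp only [Finset.sum_const, Finset.card_univ, Fintype.card_fin, nsmul_eq_mul]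
      ring
    refine (Finset.sum_le_sum fun i _ => key i).trans (le_of_eq ?_)
    simp only [Finset.sum_const, Finset.card_univ, Fintype.card_fin, nsmul_eq_mul]
    rw [mul_assoc]

end

/-! ### Paths in the random factor graph -/

section

variable {Ω : Type*} {Ψ : Set (WeightFunction Ω)}

/-- The constraint nodes `(ψ, i)` with `i < m ψ`. -/
def activeNodes (m : Ψ →₀ ℕ) : Finset (Ψ × ℕ) :=
  (m.support.sigma fun ψ => Finset.range (m ψ)).map (Equiv.sigmaEquivProd Ψ ℕ).toEmbedding

theorem mem_activeNodes {m : Ψ →₀ ℕ} {p : Ψ × ℕ} : p ∈ activeNodes m ↔ p.2 < m p.1 := by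
  obtain ⟨ψ, i⟩ := p
  simp only [activeNodes, Finset.mem_map_equiv, Finset.mem_sigma, Finset.mem_range,
    Finsupp.mem_support_iff]
  exact ⟨fun h => h.2, fun h => ⟨(Nat.zero_le _).trans_lt h |>.ne', h⟩⟩

theorem sum_activeNodes (m : Ψ →₀ ℕ) (f : Ψ → ℝ≥0∞) :
    ∑ p ∈ activeNodes m, f p.1 = ∑' ψ, m ψ * f ψ := by
  rw [activeNodes, Finset.sum_map, Finset.sum_sigma, tsum_eq_sum (s := m.support)]
  · refine Finset.sum_congr rfl fun ψ _ => ?_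
    simp
  · intro ψ hψ
    simp [Finsupp.notMem_support_iff.1 hψ]

theorem FactorGraph.bipartite_adj_inl {V F : Type*} (G : FactorGraph Ψ V F) {x : V} {v : V ⊕ F}
    (h : G.bipartite.Adj (Sum.inl x) v) : ∃ a j, v = Sum.inr a ∧ G.nbr a j = x := by
  obtain ⟨-, ⟨a, j, h1, h2⟩ | ⟨a, j, -, h2⟩⟩ := (SimpleGraph.fromRel_adj _ _ _).1 h
  · exact ⟨a, j, h2, (Sum.inl_injective h1).symm⟩
  · cases h2

theorem FactorGraph.bipartite_adj_inr {V F : Type*} (G : FactorGraph Ψ V F) {a : F} {v : V ⊕ F}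
    (h : G.bipartite.Adj (Sum.inr a) v) : ∃ j, v = Sum.inl (G.nbr a j) := by
  obtain ⟨-, ⟨b, j, h1, -⟩ | ⟨b, j, h1, h2⟩⟩ := (SimpleGraph.fromRel_adj _ _ _).1 h
  · cases h1
  · cases Sum.inr_injective h2
    exact ⟨j, h1⟩

variable [DecidableEq Ψ] {n : ℕ}

/-- Each step of `Reach` consumes two edges, through a constraint node and back to a variable node.
A path visits no constraint node twice, which allows passing to `A.erase`. -/
theorem reach_of_isPath (S : Sample Ψ n) (ℓ : ℕ) (A : Finset (Ψ × ℕ)) (x y : Fin n)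
    (p : (randomFactorGraph S).bipartite.Walk (Sum.inl x) (Sum.inl y)) (hp : p.IsPath)
    (hlen : p.length ≤ 2 * ℓ)
    (hA : ∀ a : Σ ψ : Ψ, Fin (S.1 ψ), Sum.inr a ∈ p.support → (a.1, (a.2 : ℕ)) ∈ A) :
    Reach S.2 ℓ A x y := by
  induction ℓ generalizing A x with
  | zero =>
    cases p with
    | nil => rfl
    | cons h q => simp at hlen
  | succ ℓ ih =>
    cases p with
    | nil => exact Reach.refl _ _ _ _
    | cons h q =>
      obtain ⟨a, i, rfl, hi⟩ := (randomFactorGraph S).bipartite_adj_inl h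
      cases q with
      | cons h' r =>
        obtain ⟨j, rfl⟩ := (randomFactorGraph S).bipartite_adj_inr h'
        rw [SimpleGraph.Walk.cons_isPath_iff, SimpleGraph.Walk.cons_isPath_iff] at hp
        refine Or.inr ⟨(a.1, (a.2 : ℕ)), hA a (by simp), i, j, hi, ?_⟩
        have hlen' : r.length + 1 + 1 ≤ 2 * ℓ + 1 + 1 := hlen
        refine ih _ _ r hp.1.1 (Nat.le_of_succ_le_succ (Nat.le_of_succ_le_succ hlen')) ?_
        intro b hb
        refine Finset.mem_erase.2 ⟨fun hab => hp.1.2 ?_, hA b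
          (List.mem_cons_of_mem _ (List.mem_cons_of_mem _ hb))⟩
        have : b = a := by
          obtain ⟨b1, b2⟩ := b
          obtain ⟨a1, a2⟩ := a
          obtain ⟨rfl, h2⟩ := Prod.ext_iff.1 hab
          exact congrArg _ (Fin.ext h2)
        rwa [this] at hb

theorem reach_of_notMem_farSet {S : Sample Ψ n} {m : Ψ →₀ ℕ} (hm : S.1 = m) {ℓ : ℕ} {x y : Fin n}
    (h : y ∉ (randomFactorGraph S).farSet ℓ x) : Reach S.2 ℓ (activeNodes m) x y := by
  classical
  have hle : (randomFactorGraph S).bipartite.edist (Sum.inl x) (Sum.inl y) ≤ ((2 * ℓ : ℕ) : ℕ∞) :=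
    not_lt.1 h
  have hne : (randomFactorGraph S).bipartite.edist (Sum.inl x) (Sum.inl y) ≠ ⊤ :=
    (hle.trans_lt (ENat.natCast_lt_top _)).ne
  obtain ⟨p, hp⟩ := SimpleGraph.exists_walk_of_edist_ne_top hne
  rw [← hp, Nat.cast_le] at hle
  refine reach_of_isPath S ℓ _ x y p.bypass p.bypass_isPath (p.length_bypass_le_length.trans hle) ?_
  intro a _
  rw [mem_activeNodes, ← hm]
  exact a.2.2

end

/-! ### Typical neighbourhoods are small -/

theorem lintegral_cast_poissonMeasure (r : ℝ≥0) :
    ∫⁻ m : ℕ, (m : ℝ≥0∞) ∂(poissonMeasure r) = r := by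
  have h : ∀ m : ℕ, poissonMeasure r {m + 1} * ((m + 1 : ℕ) : ℝ≥0∞) = r * poissonMeasure r {m} := by
    intro m
    rw [poissonMeasure_singleton, poissonMeasure_singleton, ← ENNReal.ofReal_natCast,
      ← ENNReal.ofReal_mul (by positivity), ← ENNReal.ofReal_coe_nnreal,
      ← ENNReal.ofReal_mul (by positivity)]
    congr 1
    rw [Nat.factorial_succ, pow_succ]
    push_cast
    field_simp
  rw [lintegral_countable', tsum_eq_zero_add' ENNReal.summable]
  simp_rw [mul_comm (Nat.cast _) (poissonMeasure r _)]
  simp_rw [h, ENNReal.tsum_mul_left]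
  have h1 : ∑' m : ℕ, poissonMeasure r {m} = 1 := by
    have := measure_iUnion (μ := poissonMeasure r) (f := fun m : ℕ => ({m} : Set ℕ))
      (fun i j hij => Set.disjoint_singleton.2 hij) fun m => measurableSet_singleton m
    rw [← this, Set.iUnion_singleton_eq_range]
    simp
  rw [h1]
  simp

section

variable {Ω : Type*} {Ψ : Set (WeightFunction Ω)}

/-- The law of the numbers of constraint nodes of each type. -/
abbrev countLaw (ρ : Ψ → ℝ≥0) (n : ℕ) : Measure (Ψ → ℕ) :=
  Measure.infinitePi fun ψ : Ψ => poissonMeasure (n * ρ ψ)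

theorem lintegral_eval_countLaw (ρ : Ψ → ℝ≥0) (n : ℕ) (ψ : Ψ) :
    ∫⁻ m, (m ψ : ℝ≥0∞) ∂(countLaw ρ n) = n * ρ ψ := by
  have h := (measurePreserving_eval_infinitePi (fun ψ : Ψ => poissonMeasure (n * ρ ψ)) ψ).lintegral_comp
    (f := fun m : ℕ => (m : ℝ≥0∞)) (measurable_of_countable _)
  rw [lintegral_cast_poissonMeasure] at h
  simpa using h

/-- A summable family has countable support, and here every term is positive. -/
theorem countable_of_summable_arity {ρ : Ψ → ℝ≥0} (hρ : ∀ ψ, 0 < ρ ψ)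
    (hsum : Summable fun ψ : Ψ => (ρ ψ : ℝ) * (ψ.1.arity : ℝ)) : Countable Ψ := by
  have h := hsum.countable_support
  have : Function.support (fun ψ : Ψ => (ρ ψ : ℝ) * (ψ.1.arity : ℝ)) = Set.univ := by
    ext ψ
    have h1 : (0 : ℝ) < ρ ψ := hρ ψ
    have h2 : (0 : ℝ) < ψ.1.arity := by exact_mod_cast ψ.1.one_le_arity
    simp [h1.ne', h2.ne']
  rw [this] at h
  exact Set.countable_univ_iff.1 h

/-- A size-biased sum over the constraint nodes that bounds the growth of a neighbourhood. -/
def growth (m : Ψ → ℕ) (n : ℕ) (t : ℝ≥0∞) : ℝ≥0∞ :=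
  ∑' ψ : Ψ, m ψ * (ψ.1.arity * (n : ℝ≥0∞)⁻¹ * min 1 (ψ.1.arity * t))

/-- The mean of `growth`. -/
def meanGrowth (ρ : Ψ → ℝ≥0) (t : ℝ≥0∞) : ℝ≥0∞ :=
  ∑' ψ : Ψ, ρ ψ * ψ.1.arity * min 1 (ψ.1.arity * t)

/-- The bound for the connection probabilities that is obtained by iterating `growth`. -/
def levelBound (m : Ψ → ℕ) (n : ℕ) : ℕ → ℝ≥0∞
  | 0 => 0
  | ℓ + 1 => growth m n ((n : ℝ≥0∞)⁻¹ + levelBound m n ℓ)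

theorem growth_mono (m : Ψ → ℕ) (n : ℕ) : Monotone (growth m n) := fun s t hst => by
  unfold growth
  gcongr

theorem reachBound_activeNodes (m : Ψ →₀ ℕ) (n ℓ : ℕ) :
    reachBound (fun p : Ψ × ℕ => p.1.1.arity) n (activeNodes m) ℓ = levelBound m n ℓ := by
  induction ℓ with
  | zero => rfl
  | succ ℓ ih =>
    rw [reachBound, levelBound, ih]
    exact sum_activeNodes m fun ψ => ψ.1.arity * (n : ℝ≥0∞)⁻¹ *
      min 1 (ψ.1.arity * ((n : ℝ≥0∞)⁻¹ + levelBound m n ℓ))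

theorem lintegral_growth [Countable Ψ] (ρ : Ψ → ℝ≥0) (n : ℕ) [NeZero n] (t : ℝ≥0∞) :
    ∫⁻ m, growth m n t ∂(countLaw ρ n) = meanGrowth ρ t := by
  have hm : ∀ ψ : Ψ, Measurable fun m : Ψ → ℕ => (m ψ : ℝ≥0∞) := fun ψ =>
    (measurable_of_countable (fun k : ℕ => (k : ℝ≥0∞))).comp (measurable_pi_apply ψ)
  unfold growth
  rw [lintegral_tsum fun ψ => ((hm ψ).mul_const _).aemeasurable]
  refine tsum_congr fun ψ => ?_
  rw [lintegral_mul_const _ (hm ψ), lintegral_eval_countLaw]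
  have hn : (n : ℝ≥0∞) ≠ 0 := by exact_mod_cast NeZero.ne n
  rw [show (n : ℝ≥0∞) * ρ ψ * (ψ.1.arity * (n : ℝ≥0∞)⁻¹ * min 1 (ψ.1.arity * t)) =
    (n * (n : ℝ≥0∞)⁻¹) * (ρ ψ * ψ.1.arity * min 1 (ψ.1.arity * t)) by ring,
    ENNReal.mul_inv_cancel hn (ENNReal.natCast_ne_top n), one_mul]

theorem measurable_growth [Countable Ψ] (n : ℕ) (t : ℝ≥0∞) :
    Measurable fun m : Ψ → ℕ => growth m n t := by
  refine Measurable.tsum fun ψ => Measurable.mul_const ?_ _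
  exact (measurable_of_countable (fun k : ℕ => (k : ℝ≥0∞))).comp (measurable_pi_apply ψ)

theorem tsum_arity_ne_top {ρ : Ψ → ℝ≥0}
    (hsum : Summable fun ψ : Ψ => (ρ ψ : ℝ) * (ψ.1.arity : ℝ)) :
    ∑' ψ : Ψ, (ρ ψ : ℝ≥0∞) * ψ.1.arity ≠ ∞ := by
  have : ∀ ψ : Ψ, (ρ ψ : ℝ≥0∞) * ψ.1.arity = ((ρ ψ * (ψ.1.arity : ℝ≥0) : ℝ≥0) : ℝ≥0∞) :=
    fun ψ => by push_cast; rfl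
  simp_rw [this]
  rw [ENNReal.tsum_coe_ne_top_iff_summable, ← NNReal.summable_coe]
  simpa using hsum

/-- Dominated convergence by hand: on the tail `min ≤ 1` leaves a tail of `∑ ρ k`, and each of the
finitely many other terms is at most linear in `t`. No second moment of the arities is needed. -/
theorem tendsto_meanGrowth {ρ : Ψ → ℝ≥0}
    (hsum : Summable fun ψ : Ψ => (ρ ψ : ℝ) * (ψ.1.arity : ℝ)) :
    Tendsto (meanGrowth ρ) (𝓝 0) (𝓝 0) := by
  refine ENNReal.tendsto_nhds_zero.2 fun ε hε => ?_
  have h2 : ε / 2 ≠ 0 := (ENNReal.half_pos hε.ne').ne'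
  have htail := ENNReal.tendsto_tsum_compl_atTop_zero (tsum_arity_ne_top hsum)
  obtain ⟨s, hs⟩ := ((ENNReal.tendsto_nhds_zero.1 htail) _ (pos_iff_ne_zero.2 h2)).exists
  have hfin : Tendsto (fun t : ℝ≥0∞ => ∑ ψ ∈ s, (ρ ψ : ℝ≥0∞) * ψ.1.arity * (ψ.1.arity * t))
      (𝓝 0) (𝓝 0) := by
    have : Tendsto (fun t : ℝ≥0∞ => ∑ ψ ∈ s, (ρ ψ : ℝ≥0∞) * ψ.1.arity * (ψ.1.arity * t))
      (𝓝 0) (𝓝 (∑ ψ ∈ s, (ρ ψ : ℝ≥0∞) * ψ.1.arity * (ψ.1.arity * 0))) := by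
      refine tendsto_finsetSum _ fun ψ _ => ?_
      refine ENNReal.Tendsto.const_mul (ENNReal.Tendsto.const_mul tendsto_id (Or.inr ?_)) (Or.inr ?_)
      · exact ENNReal.natCast_ne_top _
      · exact ENNReal.mul_ne_top ENNReal.coe_ne_top (ENNReal.natCast_ne_top _)
    simpa using this
  filter_upwards [ENNReal.tendsto_nhds_zero.1 hfin _ (pos_iff_ne_zero.2 h2)] with t ht
  unfold meanGrowth
  rw [← ENNReal.sum_add_tsum_compl s, ← ENNReal.add_halves ε]
  refine add_le_add (le_trans (Finset.sum_le_sum fun ψ _ => ?_) ht)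
    (le_trans (ENNReal.tsum_le_tsum fun ψ => ?_) hs)
  · exact mul_le_mul_right (min_le_right _ _) _
  · exact mul_le_of_le_one_right' (min_le_left _ _)

/-- Induction on `ℓ` with Markov's inequality. The previous level depends on the same counts `m`, so
it is first replaced by a deterministic bound `u / 2`. Monotonicity of `growth` then leaves `growth
m (n + 1) u`, whose mean is explicit. -/
theorem tendsto_countLaw_levelBound [Countable Ψ] {ρ : Ψ → ℝ≥0}
    (hsum : Summable fun ψ : Ψ => (ρ ψ : ℝ) * (ψ.1.arity : ℝ)) (ℓ : ℕ) {t : ℝ≥0∞} (ht : 0 < t) :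
    Tendsto (fun n : ℕ => countLaw ρ (n + 1) {m | t < levelBound m (n + 1) ℓ}) atTop (𝓝 0) := by
  induction ℓ generalizing t with
  | zero => simp [levelBound]
  | succ ℓ ih =>
    rcases eq_or_ne t ∞ with rfl | htop
    · simp
    refine ENNReal.tendsto_nhds_zero.2 fun δ hδ => ?_
    have h2 : 0 < δ / 2 := ENNReal.half_pos hδ.ne'
    have hpos : 0 < t * (δ / 2) := ENNReal.mul_pos ht.ne' h2.ne'
    obtain ⟨u, hu, hgu⟩ : ∃ u : ℝ≥0∞, 0 < u ∧ meanGrowth ρ u ≤ t * (δ / 2) := by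
      have h1 := ENNReal.tendsto_nhds_zero.1 (tendsto_meanGrowth hsum) _ hpos
      obtain ⟨u, hu, hu'⟩ := (ENNReal.nhds_zero_basis_Iic.eventually_iff).1 h1
      exact ⟨u, hu, hu' (Set.mem_Iic.2 le_rfl)⟩
    have hinv : ∀ᶠ n : ℕ in atTop, ((n + 1 : ℕ) : ℝ≥0∞)⁻¹ ≤ u / 2 :=
      ENNReal.tendsto_nhds_zero.1 ((tendsto_add_atTop_iff_nat 1).2
        ENNReal.tendsto_inv_nat_nhds_zero) _ (ENNReal.half_pos hu.ne')
    filter_upwards [hinv, ENNReal.tendsto_nhds_zero.1 (ih (ENNReal.half_pos hu.ne')) _ h2]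
      with n hn hih
    have hsub : {m : Ψ → ℕ | t < levelBound m (n + 1) (ℓ + 1)} ⊆
        {m | u / 2 < levelBound m (n + 1) ℓ} ∪ {m | t ≤ growth m (n + 1) u} := by
      intro m hm
      by_cases hc : u / 2 < levelBound m (n + 1) ℓ
      · exact Or.inl hc
      · refine Or.inr ((le_of_lt hm).trans (growth_mono m (n + 1) ?_))
        rw [← ENNReal.add_halves u]
        exact add_le_add hn (not_lt.1 hc)
    refine (measure_mono hsub).trans ((measure_union_le _ _).trans ?_)
    rw [← ENNReal.add_halves δ]
    refine add_le_add hih ?_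
    refine (meas_ge_le_lintegral_div (measurable_growth _ _).aemeasurable ht.ne' htop).trans ?_
    rw [lintegral_growth]
    refine ENNReal.div_le_of_le_mul ?_
    rwa [mul_comm]

/-- The expected number of constraint nodes is `n ∑ ρ ≤ n ∑ ρ k < ∞`, since arities are at least
`1`. Finitely supported counts form a countable set, so later arguments can run over slices `{m} ×ˢ
_`. -/
theorem ae_finite_support_countLaw [Countable Ψ] {ρ : Ψ → ℝ≥0}
    (hsum : Summable fun ψ : Ψ => (ρ ψ : ℝ) * (ψ.1.arity : ℝ)) (n : ℕ) :
    ∀ᵐ (m : Ψ → ℕ) ∂(countLaw ρ n), ∃ m' : Ψ →₀ ℕ, m = m' := by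
  have hm : ∀ ψ : Ψ, Measurable fun m : Ψ → ℕ => (m ψ : ℝ≥0∞) := fun ψ =>
    (measurable_of_countable (fun k : ℕ => (k : ℝ≥0∞))).comp (measurable_pi_apply ψ)
  have hint : ∫⁻ m, ∑' ψ : Ψ, (m ψ : ℝ≥0∞) ∂(countLaw ρ n) ≠ ∞ := by
    rw [lintegral_tsum fun ψ => (hm ψ).aemeasurable]
    simp_rw [lintegral_eval_countLaw, ENNReal.tsum_mul_left]
    refine ENNReal.mul_ne_top (ENNReal.natCast_ne_top n) (ne_top_of_le_ne_top
      (tsum_arity_ne_top hsum) (ENNReal.tsum_le_tsum fun ψ => ?_))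
    refine le_mul_of_one_le_right' ?_
    exact_mod_cast ψ.1.one_le_arity
  filter_upwards [ae_lt_top (Measurable.tsum hm) hint] with m hfin
  have h1 : Set.Finite {ψ : Ψ | (1 : ℝ≥0∞) ≤ m ψ} :=
    ENNReal.finite_const_le_of_tsum_ne_top hfin.ne one_ne_zero
  have h2 : Function.support m ⊆ {ψ : Ψ | (1 : ℝ≥0∞) ≤ m ψ} := fun ψ hψ => by
    have : 1 ≤ m ψ := Nat.one_le_iff_ne_zero.2 hψ
    exact_mod_cast this
  exact ⟨Finsupp.ofSupportFinite m (h1.subset h2), rfl⟩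

theorem sampleLaw_notMem_farSet_le [Countable Ψ] {ρ : Ψ → ℝ≥0}
    (hsum : Summable fun ψ : Ψ => (ρ ψ : ℝ) * (ψ.1.arity : ℝ)) (n : ℕ) [NeZero n] (ℓ : ℕ)
    {x y : Fin n} (hxy : x ≠ y) (t : ℝ≥0∞) :
    sampleLaw Ψ ρ n {S | y ∉ (randomFactorGraph S).farSet ℓ x} ≤
      countLaw ρ n {m | t < levelBound m n ℓ} + t := by
  classical
  let k : Ψ × ℕ → ℕ := fun p => p.1.1.arity
  let R : (Ψ →₀ ℕ) → Set ((p : Ψ × ℕ) → Fin (k p) → Fin n) := fun m =>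
    {nb | levelBound m n ℓ ≤ t ∧ Reach nb ℓ (activeNodes m) x y}
  have hlaw : sampleLaw Ψ ρ n = (countLaw ρ n).prod (tupleLaw k n) := rfl
  -- Apart from a null set and the event of a large level bound, the event is covered by countably
  -- many slices with fixed counts. Each slice is a rectangle, so its measure is a product.
  have hsub : {S : Sample Ψ n | y ∉ (randomFactorGraph S).farSet ℓ x} ⊆
      ({m : Ψ → ℕ | ¬ ∃ m' : Ψ →₀ ℕ, m = m'} ×ˢ Set.univ ∪ {m | t < levelBound m n ℓ} ×ˢ Set.univ) ∪
        ⋃ m : Ψ →₀ ℕ, {⇑m} ×ˢ R m := by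
    intro S hS
    by_cases h1 : ∃ m' : Ψ →₀ ℕ, S.1 = m'
    · obtain ⟨m, hm⟩ := h1
      by_cases h2 : t < levelBound S.1 n ℓ
      · exact Or.inl (Or.inr ⟨h2, trivial⟩)
      · refine Or.inr (Set.mem_iUnion.2 ⟨m, hm, ?_, reach_of_notMem_farSet hm hS⟩)
        rw [← hm]
        exact not_lt.1 h2
    · exact Or.inl (Or.inl ⟨h1, trivial⟩)
  rw [hlaw]
  refine (measure_mono hsub).trans ((measure_union_le _ _).trans (add_le_add
    ((measure_union_le _ _).trans ?_) ?_))
  · rw [Measure.prod_prod, Measure.prod_prod, measure_univ, mul_one, mul_one,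
      show countLaw ρ n {m : Ψ → ℕ | ¬ ∃ m' : Ψ →₀ ℕ, m = m'} = 0 from ae_finite_support_countLaw hsum n,
      zero_add]
  · refine (measure_iUnion_le _).trans ?_
    have hR : ∀ m, tupleLaw k n (R m) ≤ t := by
      intro m
      by_cases hm : levelBound m n ℓ ≤ t
      · refine (measure_mono fun nb h => h.2).trans ((tupleLaw_reach_le (activeNodes m) ℓ _
          (Finset.Subset.refl _) hxy).trans ?_)
        rwa [reachBound_activeNodes]
      · have : R m = ∅ := Set.eq_empty_of_forall_notMem fun nb h => hm h.1
        rw [this, measure_empty]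
        exact zero_le
    have h1 : ∑' m : Ψ →₀ ℕ, countLaw ρ n {⇑m} ≤ 1 := by
      rw [← measure_iUnion]
      · exact prob_le_one
      · exact fun m m' h => Set.disjoint_singleton.2 fun h' => h (DFunLike.coe_injective h')
      · exact fun m => measurableSet_singleton _
    calc _ ≤ ∑' m : Ψ →₀ ℕ, countLaw ρ n {⇑m} * t := by
          refine ENNReal.tsum_le_tsum fun m => ?_
          rw [Measure.prod_prod]
          gcongr
          exact hR m
      _ ≤ t := by
          rw [ENNReal.tsum_mul_right]
          exact mul_le_of_le_one_left' h1

end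

/-- If two nonnegative functions have small mean and one of them is measurable, then they are
small simultaneously somewhere. -/
theorem exists_lt_and_lt_of_lintegral_lt {X : Type*} [MeasurableSpace X] (P : Measure X)
    [IsProbabilityMeasure P] {f g : X → ℝ≥0∞} (hg : AEMeasurable g P) {a b : ℝ≥0∞}
    (ha0 : a ≠ 0) (ha : a ≠ ∞) (hb0 : b ≠ 0) (hb : b ≠ ∞) (hfa : ∫⁻ x, f x ∂P < a / 2)
    (hgb : ∫⁻ x, g x ∂P < b / 2) : ∃ x, f x < a ∧ g x < b := by
  by_contra! hcon
  have h1 : ∀ x, 1 ≤ a⁻¹ * f x + b⁻¹ * g x := by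
    intro x
    by_cases hx : f x < a
    · refine le_add_of_nonneg_of_le zero_le ?_
      rw [← ENNReal.inv_mul_cancel hb0 hb]
      gcongr
      exact hcon x hx
    · refine le_add_of_le_of_nonneg ?_ zero_le
      rw [← ENNReal.inv_mul_cancel ha0 ha]
      gcongr
      exact not_lt.1 hx
  -- Additivity of the integral needs measurability of only one summand, here `g`; nothing is
  -- required of `f`, which will be the weak cut distance.
  have h2 : (1 : ℝ≥0∞) ≤ a⁻¹ * ∫⁻ x, f x ∂P + b⁻¹ * ∫⁻ x, g x ∂P := by
    rw [← lintegral_const_mul' _ _ (ENNReal.inv_ne_top.2 ha0),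
      ← lintegral_const_mul' _ _ (ENNReal.inv_ne_top.2 hb0),
      ← lintegral_add_right' _ (hg.const_mul _)]
    calc (1 : ℝ≥0∞) = ∫⁻ _, 1 ∂P := by simp
      _ ≤ _ := lintegral_mono h1
  have h3 : a⁻¹ * ∫⁻ x, f x ∂P < a⁻¹ * (a / 2) :=
    (ENNReal.mul_lt_mul_iff_right (ENNReal.inv_ne_zero.2 ha) (ENNReal.inv_ne_top.2 ha0)).2 hfa
  have h4 : b⁻¹ * ∫⁻ x, g x ∂P < b⁻¹ * (b / 2) :=
    (ENNReal.mul_lt_mul_iff_right (ENNReal.inv_ne_zero.2 hb) (ENNReal.inv_ne_top.2 hb0)).2 hgb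
  have h5 : ∀ c : ℝ≥0∞, c ≠ 0 → c ≠ ∞ → c⁻¹ * (c / 2) = 2⁻¹ := fun c hc0 hc => by
    rw [div_eq_mul_inv, ← mul_assoc, ENNReal.inv_mul_cancel hc0 hc, one_mul]
  rw [h5 a ha0 ha] at h3
  rw [h5 b hb0 hb] at h4
  have := h2.trans_lt (ENNReal.add_lt_add h3 h4)
  rw [ENNReal.inv_two_add_inv_two] at this
  exact lt_irrefl _ this

/-! ### Functions of the random factor graph -/

section

variable {Ω : Type*} {Ψ : Set (WeightFunction Ω)}

instance (ρ : Ψ → ℝ≥0) (n : ℕ) [NeZero n] : IsProbabilityMeasure (sampleLaw Ψ ρ n) :=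
  inferInstanceAs (IsProbabilityMeasure
    ((countLaw ρ n).prod (tupleLaw (fun p : Ψ × ℕ => p.1.1.arity) n)))

/-- A function that depends only on the neighbour tuples of the constraint nodes that are present
is almost everywhere measurable. -/
theorem aemeasurable_sampleLaw [Countable Ψ] {ρ : Ψ → ℝ≥0}
    (hsum : Summable fun ψ : Ψ => (ρ ψ : ℝ) * (ψ.1.arity : ℝ)) {n : ℕ} [NeZero n]
    {f : Sample Ψ n → ℝ≥0∞}
    (hf : ∀ m nb nb', (∀ p : Ψ × ℕ, p.2 < m p.1 → nb p = nb' p) → f (m, nb) = f (m, nb')) :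
    AEMeasurable f (sampleLaw Ψ ρ n) := by
  classical
  let good : Set (Sample Ψ n) := {S | ∃ m : Ψ →₀ ℕ, S.1 = m}
  have hlaw : sampleLaw Ψ ρ n =
    (countLaw ρ n).prod (tupleLaw (fun p : Ψ × ℕ => p.1.1.arity) n) := rfl
  have hgood : ∀ᵐ S ∂(sampleLaw Ψ ρ n), S ∈ good := by
    rw [hlaw]
    exact Measure.quasiMeasurePreserving_fst.ae (ae_finite_support_countLaw hsum n)
  -- For fixed finitely supported counts, `f` depends on finitely many tuples with finitely many
  -- values. The set is therefore a countable union of cylinders, for every `B`, measurable or not.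
  have hpre : ∀ B : Set ℝ≥0∞, MeasurableSet (good ∩ f ⁻¹' B) := by
    intro B
    have : good ∩ f ⁻¹' B = ⋃ m : Ψ →₀ ℕ, {⇑m} ×ˢ {nb | f (⇑m, nb) ∈ B} := by
      ext S
      simp only [Set.mem_iUnion, Set.mem_prod, Set.mem_inter_iff]
      constructor
      · rintro ⟨⟨m, hm⟩, hS⟩
        refine ⟨m, hm, ?_⟩
        change f (⇑m, S.2) ∈ B
        rw [← hm]
        exact hS
      · rintro ⟨m, hm, hS⟩
        have hm' : S.1 = m := hm
        refine ⟨⟨m, hm'⟩, ?_⟩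
        change f (S.1, S.2) ∈ B
        rw [hm']
        exact hS
    rw [this]
    refine MeasurableSet.iUnion fun m => (measurableSet_singleton _).prod ?_
    rw [eq_preimage_restrict (activeNodes m) {nb | f (⇑m, nb) ∈ B} fun nb nb' h hnb => by
      change f _ ∈ B
      rw [← hf (⇑m) nb nb' fun p hp => h p (mem_activeNodes.2 hp)]
      exact hnb]
    exact (Finset.measurable_restrict (activeNodes m)) (Set.toFinite _).measurableSet
  have hgm : MeasurableSet good := by simpa using hpre Set.univ
  refine ⟨good.indicator f, fun B hB => ?_, ?_⟩
  · rw [Set.indicator_preimage]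
    refine MeasurableSet.union ?_ ((measurable_const (a := (0 : ℝ≥0∞)) hB).diff hgm)
    rw [Set.inter_comm]
    exact hpre B
  · filter_upwards [hgood] with S hS
    exact (Set.indicator_of_mem hS f).symm

/-- The sample with the variable nodes renamed. -/
def relabelSample {n : ℕ} (e : Equiv.Perm (Fin n)) (S : Sample Ψ n) : Sample Ψ n :=
  (S.1, fun p j => e (S.2 p j))

theorem measurePreserving_relabelSample (ρ : Ψ → ℝ≥0) {n : ℕ} [NeZero n]
    (e : Equiv.Perm (Fin n)) :
    MeasurePreserving (relabelSample e) (sampleLaw Ψ ρ n) (sampleLaw Ψ ρ n) := by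
  have h : MeasurePreserving (fun (nb : (p : Ψ × ℕ) → Fin p.1.1.arity → Fin n) p j => e (nb p j))
      (tupleLaw (fun p : Ψ × ℕ => p.1.1.arity) n) (tupleLaw (fun p : Ψ × ℕ => p.1.1.arity) n) := by
    refine ⟨measurable_pi_lambda _ fun p => (measurable_of_finite
      (fun (t : Fin p.1.1.arity → Fin n) j => e (t j))).comp (measurable_pi_apply p), ?_⟩
    have h1 := Measure.infinitePi_map_pi (fun p : Ψ × ℕ => uniformTuple p.1.1.arity n)
      (f := fun p (t : Fin p.1.1.arity → Fin n) j => e (t j)) fun p => measurable_of_finite _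
    refine h1.trans ?_
    simp_rw [uniformTuple_map_perm]
  exact (MeasurePreserving.id _).prod h

variable [Fintype Ω] [MeasurableSpace Ω]

theorem aemeasurable_pairCorrelation [Countable Ψ] {ρ : Ψ → ℝ≥0}
    (hsum : Summable fun ψ : Ψ => (ρ ψ : ℝ) * (ψ.1.arity : ℝ)) {n : ℕ} [NeZero n] (x y : Fin n) :
    AEMeasurable (fun S => (randomFactorGraph S).pairCorrelation x y) (sampleLaw Ψ ρ n) := by
  refine aemeasurable_sampleLaw hsum fun m nb nb' h => ?_
  have : randomFactorGraph ((m, nb) : Sample Ψ n) = randomFactorGraph ((m, nb') : Sample Ψ n) := by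
    unfold randomFactorGraph
    congr 1
    funext a
    exact h (a.1, (a.2 : ℕ)) a.2.2
  change (randomFactorGraph ((m, nb) : Sample Ψ n)).pairCorrelation x y =
    (randomFactorGraph ((m, nb') : Sample Ψ n)).pairCorrelation x y
  rw [this]

/-! ### Decay of the mean pair correlation and choice of one good graph. -/

variable [Nonempty Ω] [MeasurableSingletonClass Ω]

/-- Relabelling by a transposition moves `x` to node `0`, where the influence is controlled. The
influence bounds the correlation when the other node is far, and the trivial bound `1` is used
otherwise. -/
theorem lintegral_pairCorrelation_le [Countable Ψ] {ρ : Ψ → ℝ≥0}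
    (hsum : Summable fun ψ : Ψ => (ρ ψ : ℝ) * (ψ.1.arity : ℝ)) (n : ℕ) [NeZero n] {x y : Fin n}
    (hxy : x ≠ y) (ℓ : ℕ) (t : ℝ≥0∞) :
    ∫⁻ S, (randomFactorGraph S).pairCorrelation x y ∂(sampleLaw Ψ ρ n) ≤
      expectedInfluence ρ ℓ n + (countLaw ρ n {m | t < levelBound m n ℓ} + t) := by
  let e := Equiv.swap (0 : Fin n) x
  have he := measurePreserving_relabelSample ρ e
  have hpc := aemeasurable_pairCorrelation hsum x y
  rw [← he.map_eq] at hpc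
  have h1 := lintegral_map' hpc he.measurable.aemeasurable
  rw [he.map_eq] at h1
  have h2 : ∀ S : Sample Ψ n, (randomFactorGraph (relabelSample e S)).pairCorrelation x y =
      (randomFactorGraph S).pairCorrelation 0 (e y) := by
    intro S
    have h := FactorGraph.pairCorrelation_relabel (randomFactorGraph S) e 0 (e y)
    rw [show e 0 = x by simp [e], show e (e y) = y by simp [e]] at h
    exact h
  simp_rw [h2] at h1
  have hne : (0 : Fin n) ≠ e y := by
    intro h
    have : e x = e y := by rw [← h]; simp [e]
    exact hxy (e.injective this)
  rw [h1]
  let bad := {S : Sample Ψ n | e y ∉ (randomFactorGraph S).farSet ℓ 0}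
  -- A measurable hull of the same measure lets the integral of the sum split without measurability
  -- of the influence.
  let bad' := toMeasurable (sampleLaw Ψ ρ n) bad
  calc ∫⁻ S, (randomFactorGraph S).pairCorrelation 0 (e y) ∂(sampleLaw Ψ ρ n)
      ≤ ∫⁻ S, ((randomFactorGraph S).influence ℓ 0 + bad'.indicator 1 S) ∂(sampleLaw Ψ ρ n) := by
        refine lintegral_mono fun S => ?_
        by_cases hS : e y ∈ (randomFactorGraph S).farSet ℓ 0
        · exact (FactorGraph.pairCorrelation_le_influence _ hS).trans le_self_add
        · have : S ∈ bad' := subset_toMeasurable _ _ hS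
          rw [Set.indicator_of_mem this]
          exact (FactorGraph.pairCorrelation_le_one _ _ _).trans le_add_self
    _ = expectedInfluence ρ ℓ n + sampleLaw Ψ ρ n bad := by
        rw [lintegral_add_right _ (measurable_one.indicator (measurableSet_toMeasurable _ _)),
          lintegral_indicator_one (measurableSet_toMeasurable _ _), measure_toMeasurable]
        rfl
    _ ≤ _ := by
        gcongr
        exact sampleLaw_notMem_farSet_le hsum n ℓ hne t

/-- Under non-reconstruction, the pair correlations vanish in mean, uniformly in the pair. -/
theorem eventually_lintegral_pairCorrelation_le [Countable Ψ] {ρ : Ψ → ℝ≥0}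
    (hsum : Summable fun ψ : Ψ => (ρ ψ : ℝ) * (ψ.1.arity : ℝ)) (hnon : NonReconstruction ρ)
    {δ : ℝ≥0∞} (hδ : 0 < δ) :
    ∀ᶠ n : ℕ in atTop, ∀ x y : Fin (n + 1), x ≠ y →
      ∫⁻ S, (randomFactorGraph S).pairCorrelation x y ∂(sampleLaw Ψ ρ (n + 1)) ≤ δ := by
  obtain ⟨L, hL, hL0⟩ := hnon
  have h2 : 0 < δ / 2 := ENNReal.half_pos hδ.ne'
  have h4 : 0 < δ / 2 / 2 := ENNReal.half_pos h2.ne'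
  -- The radius `ℓ` is fixed before `n` grows. It must be at least `1`, since `L 0` is
  -- unconstrained.
  obtain ⟨ℓ, hℓ1, hℓ⟩ := ((eventually_ge_atTop 1).and (hL0.eventually_lt_const h2)).exists
  filter_upwards [(hL ℓ hℓ1).eventually_lt_const hℓ, (tendsto_countLaw_levelBound hsum ℓ
    h4).eventually_lt_const h4] with n hn1 hn2 x y hxy
  refine (lintegral_pairCorrelation_le hsum (n + 1) hxy ℓ (δ / 2 / 2)).trans ?_
  calc _ ≤ δ / 2 + (δ / 2 / 2 + δ / 2 / 2) := by gcongr
    _ = δ := by rw [ENNReal.add_halves, ENNReal.add_halves]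

theorem exists_weakCut_lt_and_eventCov_le [Countable Ψ] {ρ : Ψ → ℝ≥0}
    (hsum : Summable fun ψ : Ψ => (ρ ψ : ℝ) * (ψ.1.arity : ℝ)) (hnon : NonReconstruction ρ)
    (μ : Measure (StepSpace Ω))
    (hconv : Tendsto (fun n : ℕ => expectedCut ρ μ (n + 1)) atTop (𝓝 0)) {ε : ℝ} (hε : 0 < ε) :
    ∃ (n : ℕ) (_ : NeZero n) (P : Measure (Fin n → Ω)), IsProbabilityMeasure P ∧
      weakCut (hatMeasure n P) μ < ENNReal.ofReal ε ∧
        ∀ ω, ∑ i, ∑ j, |eventCov P ω i j| ≤ ε * n ^ 2 := by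
  classical
  have hε' : ENNReal.ofReal ε ≠ 0 := (ENNReal.ofReal_pos.2 hε).ne'
  have hε8 : 0 < ε / 8 := by positivity
  have hinv : ∀ᶠ n : ℕ in atTop, ((n + 1 : ℕ) : ℝ)⁻¹ < ε / 8 :=
    ((tendsto_add_atTop_iff_nat 1).2 tendsto_inv_atTop_nhds_zero_nat).eventually_lt_const hε8
  obtain ⟨n, hn1, hn2, hn3⟩ := ((hconv.eventually_lt_const (ENNReal.half_pos hε')).and
    ((eventually_lintegral_pairCorrelation_le hsum hnon (ENNReal.ofReal_pos.2 hε8)).and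
      hinv)).exists
  let W : Sample Ψ (n + 1) → ℝ≥0∞ := fun S =>
    ∑ i, ∑ j, 2 * (randomFactorGraph S).pairCorrelation i j
  have hWm : AEMeasurable W (sampleLaw Ψ ρ (n + 1)) :=
    Finset.aemeasurable_fun_sum _ fun i _ => Finset.aemeasurable_fun_sum _ fun j _ =>
      (aemeasurable_pairCorrelation hsum i j).const_mul _
  have hpos : (0 : ℝ) < (n + 1 : ℕ) := by positivity
  -- With `N = n + 1`, the diagonal contributes at most `2N` and the other pairs at most `ε/4` each.
  -- The sum `2N + N²ε/4` is below `εN²/2` exactly when `1/N < ε/8`.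
  have hW : ∫⁻ S, W S ∂(sampleLaw Ψ ρ (n + 1)) <
      ENNReal.ofReal (ε * ((n + 1 : ℕ) : ℝ) ^ 2) / 2 := by
    have hterm : ∀ i j : Fin (n + 1),
        ∫⁻ S, 2 * (randomFactorGraph S).pairCorrelation i j ∂(sampleLaw Ψ ρ (n + 1)) ≤
        ENNReal.ofReal (if i = j then 2 else 0) + ENNReal.ofReal (ε / 4) := by
      intro i j
      rw [lintegral_const_mul' _ _ ENNReal.ofNat_ne_top]
      by_cases hij : i = j
      · rw [if_pos hij, ENNReal.ofReal_ofNat]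
        refine le_add_right ?_
        refine mul_le_of_le_one_right' ?_
        refine (lintegral_mono fun S => FactorGraph.pairCorrelation_le_one _ _ _).trans ?_
        simp
      · rw [if_neg hij, ENNReal.ofReal_zero, zero_add]
        refine (mul_le_mul_right (hn2 i j hij) _).trans (le_of_eq ?_)
        rw [← ENNReal.ofReal_ofNat 2, ← ENNReal.ofReal_mul zero_le_two]
        congr 1
        ring
    have hsumW : ∫⁻ S, W S ∂(sampleLaw Ψ ρ (n + 1)) ≤
        ∑ i : Fin (n + 1), ∑ j : Fin (n + 1), ENNReal.ofReal ((if i = j then 2 else 0) + ε / 4) := by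
      rw [lintegral_finsetSum' _ fun i _ => Finset.aemeasurable_fun_sum _ fun j _ =>
        (aemeasurable_pairCorrelation hsum i j).const_mul _]
      refine Finset.sum_le_sum fun i _ => ?_
      rw [lintegral_finsetSum' _ fun j _ => (aemeasurable_pairCorrelation hsum i j).const_mul _]
      refine Finset.sum_le_sum fun j _ => ?_
      rw [ENNReal.ofReal_add (by split_ifs <;> norm_num) (by positivity)]
      exact hterm i j
    have hnn : ∀ i j : Fin (n + 1), (0 : ℝ) ≤ (if i = j then 2 else 0) + ε / 4 := fun i j => by
      split_ifs <;> positivity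
    refine hsumW.trans_lt ?_
    simp_rw [← ENNReal.ofReal_sum_of_nonneg fun j _ => hnn _ j]
    rw [← ENNReal.ofReal_sum_of_nonneg fun i _ => Finset.sum_nonneg fun j _ => hnn i j,
      ← ENNReal.ofReal_ofNat 2, ← ENNReal.ofReal_div_of_pos two_pos,
      ENNReal.ofReal_lt_ofReal_iff (by positivity)]
    simp only [Finset.sum_add_distrib, Finset.sum_ite_eq, Finset.mem_univ, if_true,
      Finset.sum_const, Finset.card_univ, Fintype.card_fin, nsmul_eq_mul]
    rw [inv_lt_iff_one_lt_mul₀ hpos] at hn3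
    nlinarith
  obtain ⟨S, hS1, hS2⟩ := exists_lt_and_lt_of_lintegral_lt (sampleLaw Ψ ρ (n + 1)) hWm hε'
    ENNReal.ofReal_ne_top (ENNReal.ofReal_pos.2 (by positivity)).ne' ENNReal.ofReal_ne_top hn1 hW
  refine ⟨n + 1, inferInstance, (randomFactorGraph S).gibbs, inferInstance, hS1, fun ω => ?_⟩
  rw [← ENNReal.ofReal_le_ofReal_iff (by positivity)]
  refine le_trans ?_ hS2.le
  rw [ENNReal.ofReal_sum_of_nonneg fun i _ => Finset.sum_nonneg fun j _ => abs_nonneg _]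
  refine Finset.sum_le_sum fun i _ => ?_
  rw [ENNReal.ofReal_sum_of_nonneg fun j _ => abs_nonneg _]
  exact Finset.sum_le_sum fun j _ => FactorGraph.ofReal_abs_eventCov_le _ ω i j

end

/-! ### Conclusion. -/

theorem weakCut_dirac_self {Ω : Type*} [Fintype Ω] (w : StepSpace Ω) :
    weakCut (Measure.dirac w) (Measure.dirac w) = 0 := by
  refine le_antisymm ?_ zero_le
  refine iInf₂_le_of_le (Measure.dirac (w, w)) ⟨?_, ?_⟩
    (iInf₂_le_of_le id (MeasurePreserving.id _) ?_)
  · rw [Measure.map_dirac' measurable_fst]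
  · rw [Measure.map_dirac' measurable_snd]
  · simp only [cutDiscrepancy, iSup_le_iff]
    intro B hB U _
    have hmeas : Measurable fun p : StepSpace Ω × StepSpace Ω =>
        ∫ x in U, (p.1.val x - p.2.val (id x)) := by
      have : ∀ p : StepSpace Ω × StepSpace Ω,
          ∫ x in U, (p.1.val x - p.2.val (id x)) = p.1.mass U - p.2.mass U := fun p =>
        integral_sub p.1.integrable_val.integrableOn p.2.integrable_val.integrableOn
      simp_rw [this]
      exact (((StepSpace.continuous_mass U).comp continuous_fst).sub
        ((StepSpace.continuous_mass U).comp continuous_snd)).measurable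
    have : ∫ p in B, (∫ x in U, (p.1.val x - p.2.val (id x))) ∂(Measure.dirac (w, w)) = 0 := by
      refine integral_eq_zero_of_ae (ae_restrict_of_ae ?_)
      exact (ae_dirac_iff (measurableSet_eq_fun hmeas measurable_const)).2 (by simp; rfl)
    rw [this]
    simp [tvNorm]

theorem mainTheorem3 {Ω : Type*} [Fintype Ω] [Nonempty Ω] [MeasurableSpace Ω]
    [MeasurableSingletonClass Ω]
    (Ψ : Set (WeightFunction Ω)) (ρ : Ψ → ℝ≥0) (hρ : ∀ ψ, 0 < ρ ψ)
    (hsum : Summable fun ψ : Ψ => (ρ ψ : ℝ) * (ψ.1.arity : ℝ))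
    (μ : Measure (StepSpace Ω)) [IsProbabilityMeasure μ]
    (hconv : Tendsto (fun n : ℕ => expectedCut ρ μ (n + 1)) atTop (𝓝 0))
    (hnon : NonReconstruction ρ) :
    (∃ w : StepSpace Ω,
      weakCut μ (Measure.dirac w) = 0 ∧
      Tendsto (fun n : ℕ => expectedCut ρ (Measure.dirac w) (n + 1)) atTop (𝓝 0)) ∧
    Tendsto (fun n : ℕ => ∫⁻ S, (randomFactorGraph S).pairCorrelation (0 : Fin (n + 2)) 1
      ∂(sampleLaw Ψ ρ (n + 2))) atTop (𝓝 0) := by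
  have := countable_of_summable_arity hρ hsum
  constructor
  -- Here `μ` is equal to `δ_w`, not only at distance `0` from it, so the assumed convergence is
  -- already the required one.
  · obtain ⟨w, rfl⟩ := eq_dirac_of_forall_exists_weakCut_lt μ fun ε hε =>
      exists_weakCut_lt_and_eventCov_le hsum hnon μ hconv hε
    exact ⟨w, weakCut_dirac_self w, hconv⟩
  · refine ENNReal.tendsto_nhds_zero.2 fun δ hδ => ?_
    -- The shift by one makes the index type `Fin (n + 2)`, in which `0` and `1` are distinct.
    have h := (tendsto_add_atTop_nat 1).eventually
      (eventually_lintegral_pairCorrelation_le hsum hnon hδ)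
    filter_upwards [h] with n hn
    exact hn 0 1 Fin.zero_ne_one

end
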